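/- Let $d\ge 1$ and let $\Omega\subset\mathbb{R}^d$ be a bounded domain (nonempty, open, connected) with Lipschitz boundary. Let $a,b,c\in C^{1,1}_{\mathrm{loc}}(\mathbb{R})$ be such that, for some constant $C>0$, $a>C$, $c>C$ and $b\ge 0$ on $\mathbb{R}$. For $\varphi\in L^\infty(\Omega)$, a number $\lambda$ is a Dirichlet eigenvalue with eigenfunction $w\in H^1_0(\Omega)\setminus\{0\}$ if $$\int_\Omega a(\varphi)\nabla w\cdot\nabla\eta\,dx+\int_\Omega b(\varphi)\,w\,\eta\,dx=\lambda\int_\Omega c(\varphi)\,w\,\eta\,dx\quad\text{for all }\eta\in H^1_0(\Omega),$$ and $\mu$ is a Neumann eigenvalue with eigenfunction $w\in H^1(\Omega)\setminus\{0\}$ if $$\int_\Omega a(\varphi)\nabla w\cdot\nabla\eta\,dx=\mu\int_\Omega c(\varphi)\,w\,\eta\,dx\quad\text{for all }\eta\in H^1(\Omega).$$ Let $0<\lambda_1^\varphi\le\lambda_2^\varphi\le\dots$ and $0=\mu_0^\varphi<\mu_1^\varphi\le\mu_2^\varphi\le\dots$ denote the Dirichlet and Neumann eigenvalues, repeated according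 to multiplicity. Let $L^2_\varphi(\Omega)$ be $L^2(\Omega)$ with the norm $\left(\int_\Omega c(\varphi)|u|^2\,dx\right)^{1/2}$, and let $H^1_{(0),\varphi}(\Omega)=\{w\in H^1(\Omega):\int_\Omega c(\varphi)\,w\,dx=0\}$. **Theorem.** Let $j\ge 1$ and let $(\varphi_k)_{k\in\mathbb{N}}$ be a bounded sequence in $L^\infty(\Omega)$ with $\varphi_k\to\varphi$ a.e. in $\Omega$. Then $$\lambda_j^{\varphi_k}\to\lambda_j^{\varphi}\quad\text{and}\quad\mu_j^{\varphi_k}\to\mu_j^{\varphi}\qquad\text{as }k\to\infty.$$ Furthermore, let $u_j^{D,\varphi_k}$ and $u_j^{N,\varphi_k}$ ($k\in\mathbb{N}$) be $L^2_{\varphi_k}(\Omega)$-normalized Dirichlet and Neumann eigenfunctions to the eigenvalues $\lambda_j^{\varphi_k}$ and $\mu_j^{\varphi_k}$, respectively. Then there exist $L^2_\varphi(\Omega)$-normalized eigenfunctions $\overline u_j^D\in H^1_0(\Omega)$ to $\lambda_j^\varphi$ and $\overline u_j^N\in H^1_{(0),\varphi}(\Omega)$ to $\mu_j^\varphi$ such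 that, along a common subsequence $k\to\infty$, for both $\zeta\in\{D,N\}$, $$u_j^{\zeta,\varphi_k}\rightharpoonup\overline u_j^\zeta\ \text{ weakly in }H^1(\Omega)\qquad\text{and}\qquad u_j^{\zeta,\varphi_k}\to\overline u_j^\zeta\ \text{ strongly in }L^2_\varphi(\Omega).$$ -/

import Mathlib

open MeasureTheory Filter Topology
open scoped ENNReal NNReal ContDiff

noncomputable section

namespace PhaseFieldEigen

/-- The Euclidean space `ℝ^d`. -/
abbrev Euc (d : ℕ) : Type := EuclideanSpace ℝ (Fin d)

/-- `Ω` has a Lipschitz boundary: near each of its boundary points, `Ω` is, in a suitable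
orthonormal frame with last axis `ν`, the set of points lying strictly above the graph of a
Lipschitz function `g` of the coordinates orthogonal to `ν`
(only the values of `g` on the hyperplane orthogonal to `ν` are used). -/
def HasLipschitzBoundary {d : ℕ} (Ω : Set (Euc d)) : Prop :=
  ∀ x₀ ∈ frontier Ω, ∃ (r : ℝ) (ν : Euc d) (g : Euc d → ℝ) (K : ℝ≥0),
    0 < r ∧ ‖ν‖ = 1 ∧ LipschitzWith K g ∧
      ∀ x ∈ Metric.ball x₀ r,
        (x ∈ Ω ↔ g (x - (inner ℝ ν x : ℝ) • ν) < inner ℝ ν x)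

/-- A bounded domain (nonempty, open, connected) with Lipschitz boundary. -/
structure IsBoundedLipschitzDomain {d : ℕ} (Ω : Set (Euc d)) : Prop where
  isOpen : IsOpen Ω
  isConnected : IsConnected Ω
  isBounded : Bornology.IsBounded Ω
  lipschitz : HasLipschitzBoundary Ω

/-- The class `C^{1,1}_loc(ℝ)`. -/
def IsC11Loc (f : ℝ → ℝ) : Prop :=
  ContDiff ℝ 1 f ∧ LocallyLipschitz (deriv f)

/-- Test functions: elements of `C_c^∞(Ω)`. -/
structure IsTestFunction {d : ℕ} (Ω : Set (Euc d)) (η : Euc d → ℝ) : Prop where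
  smooth : ContDiff ℝ ∞ η
  compact : HasCompactSupport η
  supp : tsupport η ⊆ Ω

/-- The real space `L²(Ω)`. -/
abbrev L2 {d : ℕ} (Ω : Set (Euc d)) : Type := Lp ℝ 2 (volume.restrict Ω)

/-- The space `L²(Ω; ℝ^d)`. -/
abbrev L2Vec {d : ℕ} (Ω : Set (Euc d)) : Type := Lp (Euc d) 2 (volume.restrict Ω)

/-- `G` is the weak gradient of `u` in `Ω`. -/
def IsWeakGradient {d : ℕ} (Ω : Set (Euc d)) (u : L2 Ω) (G : L2Vec Ω) : Prop :=
  ∀ η : Euc d → ℝ, IsTestFunction Ω η → ∀ v : Euc d,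
    ∫ x in Ω, u x * fderiv ℝ η x v = - ∫ x in Ω, (inner ℝ (G x) v : ℝ) * η x

lemma IsTestFunction.memLp {d : ℕ} {Ω : Set (Euc d)} {η : Euc d → ℝ}
    (h : IsTestFunction Ω η) : MemLp η 2 (volume.restrict Ω) :=
  h.smooth.continuous.memLp_of_hasCompactSupport h.compact

lemma IsTestFunction.memLp_fderiv {d : ℕ} {Ω : Set (Euc d)} {η : Euc d → ℝ}
    (h : IsTestFunction Ω η) (v : Euc d) :
    MemLp (fun x => fderiv ℝ η x v) 2 (volume.restrict Ω) :=
  ((h.smooth.continuous_fderiv (by simp)).clm_apply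
    continuous_const).memLp_of_hasCompactSupport (h.compact.fderiv_apply (𝕜 := ℝ) v)

lemma integrable_left {d : ℕ} {Ω : Set (Euc d)} {η : Euc d → ℝ}
    (h : IsTestFunction Ω η) (u : L2 Ω) (v : Euc d) :
    Integrable (fun x => u x * fderiv ℝ η x v) (volume.restrict Ω) :=
  (Lp.memLp u).integrable_mul (h.memLp_fderiv v)

lemma integrable_right {d : ℕ} {Ω : Set (Euc d)} {η : Euc d → ℝ}
    (h : IsTestFunction Ω η) (G : L2Vec Ω) (v : Euc d) :
    Integrable (fun x => (inner ℝ (G x) v : ℝ) * η x) (volume.restrict Ω) :=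
  ((Lp.memLp G).inner_const v).integrable_mul h.memLp

/-- The Sobolev space `H¹(Ω)`, realised as the space of pairs `(u, ∇u)` with `u ∈ L²(Ω)` and
weak gradient `∇u ∈ L²(Ω; ℝ^d)`; it inherits the inner product
`(u, v)_{L²} + (∇u, ∇v)_{L²}`. -/
def H1 {d : ℕ} (Ω : Set (Euc d)) : Submodule ℝ (WithLp 2 (L2 Ω × L2Vec Ω)) where
  carrier := {p | IsWeakGradient Ω p.fst p.snd}
  zero_mem' := by
    intro η _ v
    have h1 : ∫ x in Ω, (0 : L2 Ω) x * fderiv ℝ η x v = 0 := by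
      rw [integral_eq_zero_of_ae]
      filter_upwards [Lp.coeFn_zero ℝ 2 (volume.restrict Ω)] with x hx
      rw [hx]; simp
    have h2 : ∫ x in Ω, (inner ℝ ((0 : L2Vec Ω) x) v : ℝ) * η x = 0 := by
      rw [integral_eq_zero_of_ae]
      filter_upwards [Lp.coeFn_zero (Euc d) 2 (volume.restrict Ω)] with x hx
      rw [hx]; simp
    rw [WithLp.zero_fst, WithLp.zero_snd, h1, h2, neg_zero]
  add_mem' := by
    intro p q hp hq η hη v
    have h1 : ∫ x in Ω, (p.fst + q.fst) x * fderiv ℝ η x v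
        = ∫ x in Ω, (p.fst x * fderiv ℝ η x v + q.fst x * fderiv ℝ η x v) := by
      apply integral_congr_ae
      filter_upwards [Lp.coeFn_add p.fst q.fst] with x hx
      rw [hx, Pi.add_apply, add_mul]
    have h2 : ∫ x in Ω, (inner ℝ ((p.snd + q.snd) x) v : ℝ) * η x
        = ∫ x in Ω, ((inner ℝ (p.snd x) v : ℝ) * η x + (inner ℝ (q.snd x) v : ℝ) * η x) := by
      apply integral_congr_ae
      filter_upwards [Lp.coeFn_add p.snd q.snd] with x hx
      simp only [hx, Pi.add_apply, inner_add_left, add_mul]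
    rw [WithLp.add_fst, WithLp.add_snd, h1, h2,
      integral_add (integrable_left hη _ v) (integrable_left hη _ v),
      integral_add (integrable_right hη _ v) (integrable_right hη _ v), hp η hη v, hq η hη v,
      neg_add]
  smul_mem' := by
    intro t p hp η hη v
    have h1 : ∫ x in Ω, (t • p.fst) x * fderiv ℝ η x v
        = ∫ x in Ω, t * (p.fst x * fderiv ℝ η x v) := by
      apply integral_congr_ae
      filter_upwards [Lp.coeFn_smul t p.fst] with x hx
      rw [hx, Pi.smul_apply, smul_eq_mul, mul_assoc]
    have h2 : ∫ x in Ω, (inner ℝ ((t • p.snd) x) v : ℝ) * η x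
        = ∫ x in Ω, t * ((inner ℝ (p.snd x) v : ℝ) * η x) := by
      apply integral_congr_ae
      filter_upwards [Lp.coeFn_smul t p.snd] with x hx
      simp only [hx, Pi.smul_apply, real_inner_smul_left, mul_assoc]
    rw [WithLp.smul_fst, WithLp.smul_snd, h1, h2, integral_const_mul, integral_const_mul,
      hp η hη v, mul_neg]

/-- The `L²`-function underlying an element of `H¹(Ω)`. -/
def toL2 {d : ℕ} {Ω : Set (Euc d)} (u : H1 Ω) : L2 Ω :=
  (u : WithLp 2 (L2 Ω × L2Vec Ω)).fst

/-- The weak gradient of an element of `H¹(Ω)`. -/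
def wgrad {d : ℕ} {Ω : Set (Euc d)} (u : H1 Ω) : L2Vec Ω :=
  (u : WithLp 2 (L2 Ω × L2Vec Ω)).snd

/-- `H¹₀(Ω)`: the closure of `C_c^∞(Ω)` in `H¹(Ω)`. -/
def H10 {d : ℕ} (Ω : Set (Euc d)) : Submodule ℝ (H1 Ω) :=
  (Submodule.span ℝ {u : H1 Ω | ∃ η : Euc d → ℝ, IsTestFunction Ω η ∧
    ⇑(toL2 u) =ᵐ[volume.restrict Ω] η}).topologicalClosure

/-- Weak convergence in `H¹(Ω)`. -/
def TendstoWeaklyH1 {d : ℕ} {Ω : Set (Euc d)} (u : ℕ → H1 Ω) (u₀ : H1 Ω) : Prop :=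
  ∀ f : H1 Ω →L[ℝ] ℝ, Tendsto (fun n => f (u n)) atTop (𝓝 (f u₀))

/-- The weighted product `∫_Ω m(φ) u v dx`. -/
def weightedProd {d : ℕ} {Ω : Set (Euc d)} (m : ℝ → ℝ) (φ : Euc d → ℝ) (u v : L2 Ω) : ℝ :=
  ∫ x in Ω, m (φ x) * (u x * v x)

/-- The weighted product `∫_Ω m(φ) U · V dx` of vector fields. -/
def weightedProdVec {d : ℕ} {Ω : Set (Euc d)} (m : ℝ → ℝ) (φ : Euc d → ℝ)
    (U V : L2Vec Ω) : ℝ :=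
  ∫ x in Ω, m (φ x) * inner ℝ (U x) (V x)

/-- The norm of `L²_φ(Ω)`, that is `(∫_Ω c(φ) |u|² dx)^{1/2}`. -/
def weightedNorm {d : ℕ} {Ω : Set (Euc d)} (c : ℝ → ℝ) (φ : Euc d → ℝ) (u : L2 Ω) : ℝ :=
  Real.sqrt (weightedProd c φ u u)

/-- The space `H¹_{(0),φ}(Ω)` of all `w ∈ H¹(Ω)` with `∫_Ω c(φ) w dx = 0`. -/
def H1MeanZero {d : ℕ} (Ω : Set (Euc d)) (c : ℝ → ℝ) (φ : Euc d → ℝ) : Set (H1 Ω) :=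
  {w | ∫ x in Ω, c (φ x) * (toL2 w) x = 0}

/-- `w` is a Dirichlet eigenfunction to the eigenvalue `lam`. -/
def IsDirichletEigenfunction {d : ℕ} (Ω : Set (Euc d)) (a b c : ℝ → ℝ) (φ : Euc d → ℝ)
    (lam : ℝ) (w : H1 Ω) : Prop :=
  w ∈ H10 Ω ∧ w ≠ 0 ∧ ∀ η ∈ H10 Ω,
    weightedProdVec a φ (wgrad w) (wgrad η) + weightedProd b φ (toL2 w) (toL2 η)
      = lam * weightedProd c φ (toL2 w) (toL2 η)

/-- `w` is a Neumann eigenfunction to the eigenvalue `mu`. -/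
def IsNeumannEigenfunction {d : ℕ} (Ω : Set (Euc d)) (a c : ℝ → ℝ) (φ : Euc d → ℝ)
    (mu : ℝ) (w : H1 Ω) : Prop :=
  w ≠ 0 ∧ ∀ η : H1 Ω,
    weightedProdVec a φ (wgrad w) (wgrad η) = mu * weightedProd c φ (toL2 w) (toL2 η)

/-- The `j`-th Dirichlet eigenvalue `λ_j^φ` (`j = 1, 2, …`) in increasing order, repeated according
to multiplicity: the least `t` such that there are `j` linearly independent eigenfunctions
whose eigenvalues are at most `t`. -/
def dirichletEigenvalue {d : ℕ} (Ω : Set (Euc d)) (a b c : ℝ → ℝ) (φ : Euc d → ℝ) (j : ℕ) : ℝ :=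
  sInf {t : ℝ | ∃ w : Fin j → H1 Ω, LinearIndependent ℝ w ∧
    ∀ i, ∃ s ≤ t, IsDirichletEigenfunction Ω a b c φ s (w i)}

/-- The `j`-th Neumann eigenvalue `μ_j^φ` (`j = 0, 1, 2, …`) in increasing order, repeated
according to multiplicity, the numbering starting with the trivial eigenvalue `μ_0^φ = 0`:
the least `t` such that there are `j + 1` linearly independent eigenfunctions whose eigenvalues
are at most `t`. -/
def neumannEigenvalue {d : ℕ} (Ω : Set (Euc d)) (a c : ℝ → ℝ) (φ : Euc d → ℝ) (j : ℕ) : ℝ :=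
  sInf {t : ℝ | ∃ w : Fin (j + 1) → H1 Ω, LinearIndependent ℝ w ∧
    ∀ i, ∃ s ≤ t, IsNeumannEigenfunction Ω a c φ s (w i)}

end PhaseFieldEigen

end

open PhaseFieldEigen

/-! Both eigenvalue problems have the form `A w η = s * C w η` on a separable Hilbert space `H`,
which is `H10 Ω` or `H1 Ω`. Here `C` is comparable to `‖J ·‖²` for the embedding `J` into `L²`, and
`A + C` is coercive. Asking for coercivity of the sum only treats both problems alike, without a
Poincaré inequality. Everything rests on `J` being injective and compact.

By the min-max principle, `IsFormPair.mem_eigSet_iff`, there are `j` independent eigenvectors with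
eigenvalues at most `t` exactly when `A ≤ t * C` on some `j`-dimensional subspace. This criterion
does not mention eigenvectors and is stable under perturbation of the forms. Bounded almost
everywhere convergence of the coefficients gives, by dominated convergence, `A k v → A₀ v` and `C k
v → C₀ v` in the dual norm for each fixed `v`.

Eigenvalues cannot jump up: a subspace that is good for the limit remains almost as good for late
`k` (`FormsTendsto.eventually_mem_eigSet`). They cannot drop: orthonormal bases of good subspaces
are bounded, their weak limits remain orthonormal by compactness of `J`, and `A` is weakly lower
semicontinuous (`FormsTendsto.mem_eigSet_of_tendsto`). The same compactness yields convergent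
subsequences of eigenvectors (`FormsTendsto.exists_subseq_eig`).

Compactness of `J` (`isCompletelyContinuous_toL2`) comes from a local cone condition: averages over
small balls shifted into the domain are close to the function in `L²`, uniformly on bounded sets of
`H¹`, and for a fixed ball they turn weak convergence into pointwise convergence. The same averages
show that a zero gradient on a connected domain forces constancy. Hence the Neumann eigenvalues with
`j ≥ 1` are nonzero, and testing with `1` gives weighted mean zero. -/

namespace PhaseFieldEigen

/-! ### Weak convergence and pairs of forms on a Hilbert space -/

section Abstract

variable {H X : Type*} [NormedAddCommGroup H] [InnerProductSpace ℝ H]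
  [NormedAddCommGroup X] [NormedSpace ℝ X]

/-- Weak convergence of sequences in a normed space. -/
def WeakTendsto {H : Type*} [NormedAddCommGroup H] [InnerProductSpace ℝ H]
    (u : ℕ → H) (u₀ : H) : Prop :=
  ∀ f : H →L[ℝ] ℝ, Tendsto (fun n => f (u n)) atTop (𝓝 (f u₀))

lemma WeakTendsto.comp {u : ℕ → H} {u₀ : H} (h : WeakTendsto u u₀) {n : ℕ → ℕ}
    (hn : StrictMono n) : WeakTendsto (fun k => u (n k)) u₀ :=
  fun f => (h f).comp hn.tendsto_atTop

lemma WeakTendsto.sum_smul {ι : Type*} [Fintype ι] {u : ι → ℕ → H} {u₀ : ι → H}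
    (h : ∀ i, WeakTendsto (u i) (u₀ i)) (c : ι → ℝ) :
    WeakTendsto (fun k => ∑ i, c i • u i k) (∑ i, c i • u₀ i) := by
  intro f
  simp only [map_sum, map_smul]
  exact tendsto_finsetSum _ fun i _ => (h i f).const_smul (c i)

/-- Bounded sequences in a separable Hilbert space have weakly convergent subsequences. -/
lemma exists_weakTendsto_subseq [CompleteSpace H] [TopologicalSpace.SeparableSpace H]
    {u : ℕ → H} {R : ℝ} (hu : ∀ n, ‖u n‖ ≤ R) :
    ∃ u₀ : H, ∃ n : ℕ → ℕ, StrictMono n ∧ WeakTendsto (fun k => u (n k)) u₀ := by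
  -- Sequential Banach–Alaoglu in the dual, where Riesz representation places the sequence;
  -- separability of `H` enters here.
  have key := WeakDual.isSeqCompact_closedBall ℝ H (0 : StrongDual ℝ H) R
  obtain ⟨a, -, n, hn, ha⟩ := key
    (x := fun k => StrongDual.toWeakDual (InnerProductSpace.toDual ℝ H (u k))) (by
      intro k
      simpa using hu k)
  refine ⟨(InnerProductSpace.toDual ℝ H).symm (WeakDual.toStrongDual a), n, hn, fun f => ?_⟩
  have h1 := (WeakDual.eval_continuous ((InnerProductSpace.toDual ℝ H).symm f)).tendsto a
  have h2 := h1.comp ha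
  have e : ∀ y : H, f y = inner ℝ ((InnerProductSpace.toDual ℝ H).symm f) y := fun y => by
    rw [InnerProductSpace.toDual_symm_apply]
  have e2 : f ((InnerProductSpace.toDual ℝ H).symm (WeakDual.toStrongDual a))
      = a ((InnerProductSpace.toDual ℝ H).symm f) := by
    rw [e, real_inner_comm, InnerProductSpace.toDual_symm_apply]
    rfl
  rw [e2]
  refine h2.congr fun k => ?_
  rw [e, real_inner_comm]
  rfl

/-- The error `(f n - f₀) (u n)` is at most `‖f n - f₀‖ * R`. This strong-weak pairing is why
dual-norm convergence of `A k v` for fixed `v` is enough throughout. -/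
lemma WeakTendsto.apply_tendsto {u : ℕ → H} {u₀ : H} (h : WeakTendsto u u₀) {R : ℝ}
    (hR : ∀ n, ‖u n‖ ≤ R) {f : ℕ → H →L[ℝ] ℝ} {f₀ : H →L[ℝ] ℝ} (hf : Tendsto f atTop (𝓝 f₀)) :
    Tendsto (fun n => f n (u n)) atTop (𝓝 (f₀ u₀)) := by
  have h1 : Tendsto (fun n => (f n - f₀) (u n)) atTop (𝓝 0) := by
    have h2 : Tendsto (fun n => ‖f n - f₀‖ * R) atTop (𝓝 0) := by
      simpa using (tendsto_iff_norm_sub_tendsto_zero.1 hf).mul_const R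
    refine squeeze_zero_norm (fun n => ?_) h2
    exact ((f n - f₀).le_opNorm _).trans (by gcongr; exact hR n)
  simpa using h1.add (h f₀)

/-- A bounded linear map that turns bounded weakly convergent sequences into strongly convergent
ones. -/
def IsCompletelyContinuous (J : H →L[ℝ] X) : Prop :=
  ∀ (u : ℕ → H) (u₀ : H) (R : ℝ), (∀ n, ‖u n‖ ≤ R) → WeakTendsto u u₀ →
    Tendsto (fun n => J (u n)) atTop (𝓝 (J u₀))

/-- A pair of bounded symmetric forms: `A` nonnegative, `C` comparable to `‖J ·‖²`, and `A + C`
coercive. -/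
structure IsFormPair (J : H →L[ℝ] X) (γ M : ℝ) (A C : H →L[ℝ] H →L[ℝ] ℝ) : Prop where
  A_symm : ∀ u v, A u v = A v u
  C_symm : ∀ u v, C u v = C v u
  A_nonneg : ∀ u, 0 ≤ A u u
  C_lower : ∀ u, γ * ‖J u‖ ^ 2 ≤ C u u
  C_upper : ∀ u v, |C u v| ≤ M * ‖J u‖ * ‖J v‖
  coercive : ∀ u, γ * ‖u‖ ^ 2 ≤ A u u + C u u

/-- `w` is an eigenvector of the pair of forms `(A, C)` to the eigenvalue `s`. -/
def IsEig (A C : H →L[ℝ] H →L[ℝ] ℝ) (s : ℝ) (w : H) : Prop :=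
  w ≠ 0 ∧ ∀ η, A w η = s * C w η

/-- The Rayleigh quotient of `(A, C)` is at most `t` on the span of `w`. -/
def RayleighBound (A C : H →L[ℝ] H →L[ℝ] ℝ) (t : ℝ) {m : ℕ} (w : Fin m → H) : Prop :=
  ∀ c : Fin m → ℝ, A (∑ i, c i • w i) (∑ i, c i • w i) ≤ t * C (∑ i, c i • w i) (∑ i, c i • w i)

/-- `w` is orthonormal with respect to `C`. -/
def IsOrthonormalFor (C : H →L[ℝ] H →L[ℝ] ℝ) {m : ℕ} (w : Fin m → H) : Prop :=
  ∀ i k, C (w i) (w k) = if i = k then 1 else 0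

/-- The numbers `t` such that there are `j` linearly independent eigenvectors with eigenvalues at
most `t`. -/
def eigSet (A C : H →L[ℝ] H →L[ℝ] ℝ) (j : ℕ) : Set ℝ :=
  {t | ∃ w : Fin j → H, LinearIndependent ℝ w ∧ ∀ i, ∃ s ≤ t, IsEig A C s (w i)}

/-! ### Passing to the limit in the two forms -/

section Limits

variable {J : H →L[ℝ] X} {γ M : ℝ} {A C : ℕ → H →L[ℝ] H →L[ℝ] ℝ} {A₀ C₀ : H →L[ℝ] H →L[ℝ] ℝ}

/-- Since `J (u k)` converges strongly, the bound `C_upper`, uniform in `k`, removes `u k - u₀`;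
what remains has a fixed left argument. -/
lemma tendsto_C (hJ : IsCompletelyContinuous J) (hF : ∀ k, IsFormPair J γ M (A k) (C k))
    (hC : ∀ v, Tendsto (fun k => C k v) atTop (𝓝 (C₀ v)))
    {u v : ℕ → H} {u₀ v₀ : H} {R : ℝ} (hu : ∀ n, ‖u n‖ ≤ R) (hv : ∀ n, ‖v n‖ ≤ R)
    (hu0 : WeakTendsto u u₀) (hv0 : WeakTendsto v v₀) :
    Tendsto (fun k => C k (u k) (v k)) atTop (𝓝 (C₀ u₀ v₀)) := by
  have h1 : Tendsto (fun k => C k u₀ (v k)) atTop (𝓝 (C₀ u₀ v₀)) :=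
    hv0.apply_tendsto hv (hC u₀)
  have h2 : Tendsto (fun k => C k (u k - u₀) (v k)) atTop (𝓝 0) := by
    have h3 : Tendsto (fun k => M * ‖J (u k) - J u₀‖ * ‖J (v k)‖) atTop (𝓝 (M * 0 * ‖J v₀‖)) :=
      ((tendsto_iff_norm_sub_tendsto_zero.1 (hJ u u₀ R hu hu0)).const_mul M).mul
        (hJ v v₀ R hv hv0).norm
    rw [mul_zero, zero_mul] at h3
    refine squeeze_zero_norm (fun k => ?_) h3
    have := (hF k).C_upper (u k - u₀) (v k)
    rwa [map_sub J] at this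
  simpa using h2.add h1

/-- Positivity on `u k - u₀` bounds `A k (u k) (u k)` below by an expression affine in `u k`, and
that expression passes to the weak limit. -/
lemma lsc_A (hF : ∀ k, IsFormPair J γ M (A k) (C k))
    (hA : ∀ v, Tendsto (fun k => A k v) atTop (𝓝 (A₀ v)))
    {u : ℕ → H} {u₀ : H} {R : ℝ} (hu : ∀ n, ‖u n‖ ≤ R) (hu0 : WeakTendsto u u₀)
    {r : ℕ → ℝ} {r₀ : ℝ} (hr : Tendsto r atTop (𝓝 r₀)) (h : ∀ k, A k (u k) (u k) ≤ r k) :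
    A₀ u₀ u₀ ≤ r₀ := by
  have h1 : Tendsto (fun k => 2 * A k u₀ (u k) - A k u₀ u₀) atTop
      (𝓝 (2 * A₀ u₀ u₀ - A₀ u₀ u₀)) := by
    refine ((hu0.apply_tendsto hu (hA u₀)).const_mul 2).sub ?_
    exact ((ContinuousLinearMap.apply ℝ ℝ u₀).continuous.tendsto _).comp (hA u₀)
  have h2 : 2 * A₀ u₀ u₀ - A₀ u₀ u₀ ≤ r₀ := by
    refine le_of_tendsto_of_tendsto' h1 hr fun k => le_trans ?_ (h k)
    have h3 := (hF k).A_nonneg (u k - u₀)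
    simp only [map_sub, sub_apply] at h3
    have h4 := (hF k).A_symm (u k) u₀
    linarith
  linarith

end Limits

/-! ### The min-max principle for one pair of forms -/

section Single

variable {J : H →L[ℝ] X} {γ M : ℝ} {A C : H →L[ℝ] H →L[ℝ] ℝ}

lemma IsFormPair.C_pos (hF : IsFormPair J γ M A C) (hγ : 0 < γ) (hinj : Function.Injective J)
    {u : H} (hu : u ≠ 0) : 0 < C u u := by
  have h1 : J u ≠ 0 := fun h => hu (hinj (by rw [h, map_zero]))
  have h2 : 0 < ‖J u‖ := norm_pos_iff.2 h1
  have := hF.C_lower u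
  have : 0 < γ * ‖J u‖ ^ 2 := by positivity
  linarith

lemma IsFormPair.norm_le (hF : IsFormPair J γ M A C) (hγ : 0 < γ) {u : H} {T : ℝ}
    (h : A u u + C u u ≤ T) : ‖u‖ ≤ Real.sqrt (T / γ) := by
  refine Real.le_sqrt_of_sq_le ?_
  rw [le_div_iff₀ hγ]
  linarith [hF.coercive u]

lemma IsOrthonormalFor.apply_sum {m : ℕ} {w : Fin m → H} (hw : IsOrthonormalFor C w)
    (c : Fin m → ℝ) (k : Fin m) : C (∑ i, c i • w i) (w k) = c k := by
  simp [hw _ k]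

lemma IsOrthonormalFor.linearIndependent {m : ℕ} {w : Fin m → H} (hw : IsOrthonormalFor C w) :
    LinearIndependent ℝ w := by
  rw [Fintype.linearIndependent_iff]
  intro c hc k
  rw [← hw.apply_sum c k, hc]
  simp

/-- Direct method: the Rayleigh quotient is minimised over the `C`-orthogonal complement of the
eigenvectors `e` found so far, with `u` as the competitor that keeps the minimum below `t`. -/
lemma IsFormPair.exists_eig_of_rayleigh [CompleteSpace H] [TopologicalSpace.SeparableSpace H]
    (hF : IsFormPair J γ M A C) (hγ : 0 < γ) (hinj : Function.Injective J)
    (hJ : IsCompletelyContinuous J) {m : ℕ} {e : Fin m → H} {s : Fin m → ℝ} {t : ℝ}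
    (he : IsOrthonormalFor C e) (hs : ∀ i η, A (e i) η = s i * C (e i) η)
    {u : H} (hu : u ≠ 0) (hue : ∀ i, C u (e i) = 0) (hut : A u u ≤ t * C u u) :
    ∃ v, ∃ r ≤ t, C v v = 1 ∧ (∀ i, C v (e i) = 0) ∧ ∀ η, A v η = r * C v η := by
  set S : Set ℝ := {a | ∃ v, (∀ i, C v (e i) = 0) ∧ C v v = 1 ∧ A v v = a} with hS
  have hnormalize : ∀ w : H, w ≠ 0 → (∀ i, C w (e i) = 0) → A w w / C w w ∈ S := by
    intro w hw hwe
    have hp := hF.C_pos hγ hinj hw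
    have hq : Real.sqrt (C w w) ^ 2 = C w w := Real.sq_sqrt hp.le
    have hq0 : Real.sqrt (C w w) ≠ 0 := (Real.sqrt_pos.2 hp).ne'
    refine ⟨(Real.sqrt (C w w))⁻¹ • w, fun i => by simp [hwe i], ?_, ?_⟩
    · simp only [map_smul, smul_apply, smul_eq_mul]
      rw [← mul_assoc, ← sq, inv_pow, hq, inv_mul_cancel₀ hp.ne']
    · simp only [map_smul, smul_apply, smul_eq_mul]
      rw [← mul_assoc, ← sq, inv_pow, hq]
      field_simp
  have hbdd : BddBelow S := ⟨0, by rintro _ ⟨v, -, -, rfl⟩; exact hF.A_nonneg v⟩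
  have hne : S.Nonempty := ⟨_, hnormalize u hu hue⟩
  have hrt : sInf S ≤ t :=
    (csInf_le hbdd (hnormalize u hu hue)).trans
      ((div_le_iff₀ (hF.C_pos hγ hinj hu)).2 hut)
  have hmin : ∀ n : ℕ, ∃ v, (∀ i, C v (e i) = 0) ∧ C v v = 1 ∧ A v v ≤ sInf S + 1 / ((n : ℝ) + 1) := by
    intro n
    have hlt : sInf S < sInf S + 1 / ((n : ℝ) + 1) := by
      have : (0 : ℝ) < 1 / ((n : ℝ) + 1) := by positivity
      linarith
    obtain ⟨a, ⟨v, h1, h2, rfl⟩, h3⟩ := exists_lt_of_csInf_lt hne hlt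
    exact ⟨v, h1, h2, h3.le⟩
  choose v hve hv1 hvA using hmin
  -- The `2` collects `C v v = 1` and an excess of at most `1` over the infimum.
  have hbound : ∀ n, ‖v n‖ ≤ Real.sqrt ((sInf S + 2) / γ) := fun n => by
    refine hF.norm_le hγ ?_
    have : 1 / ((n : ℝ) + 1) ≤ 1 := by
      rw [div_le_one (by positivity)]; linarith [(n.cast_nonneg : (0 : ℝ) ≤ n)]
    linarith [hv1 n, hvA n]
  obtain ⟨v₀, n, hn, hw⟩ := exists_weakTendsto_subseq hbound
  have hC1 : C v₀ v₀ = 1 := by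
    have := tendsto_C (A := fun _ => A) (C := fun _ => C) (C₀ := C) hJ (fun _ => hF)
      (fun _ => tendsto_const_nhds) (fun k => hbound (n k)) (fun k => hbound (n k)) hw hw
    simp only [hv1] at this
    exact tendsto_nhds_unique this tendsto_const_nhds
  have hCe : ∀ i, C v₀ (e i) = 0 := fun i => by
    have := hw (C.flip (e i))
    simp only [ContinuousLinearMap.flip_apply, hve] at this
    exact tendsto_nhds_unique this tendsto_const_nhds
  have hAle : A v₀ v₀ ≤ sInf S := by
    refine lsc_A (A := fun _ => A) (C := fun _ => C) (fun _ => hF)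
      (fun _ => tendsto_const_nhds) (fun k => hbound (n k)) hw
      (r := fun k => sInf S + 1 / ((n k : ℝ) + 1)) ?_ (fun k => hvA (n k))
    simpa using (tendsto_one_div_add_atTop_nhds_zero_nat.comp hn.tendsto_atTop).const_add (sInf S)
  have hlow : ∀ w : H, (∀ i, C w (e i) = 0) → sInf S * C w w ≤ A w w := by
    intro w hwe
    rcases eq_or_ne w 0 with rfl | hw0
    · simp
    · exact (le_div_iff₀ (hF.C_pos hγ hinj hw0)).1 (csInf_le hbdd (hnormalize w hw0 hwe))
  have hvar : ∀ w : H, (∀ i, C w (e i) = 0) → A v₀ w = sInf S * C v₀ w := by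
    intro w hwe
    -- Euler–Lagrange equation: this quadratic in `τ` has constant term `0`, so a nonpositive
    -- discriminant kills its linear coefficient.
    have hq : ∀ τ : ℝ, 0 ≤ (A w w - sInf S * C w w) * (τ * τ)
        + 2 * (A v₀ w - sInf S * C v₀ w) * τ + 0 := by
      intro τ
      have h1 := hlow (v₀ + τ • w) (fun i => by simp [hCe i, hwe i])
      simp only [map_add, map_smul, add_apply, smul_apply,
        smul_eq_mul, hF.A_symm w v₀, hF.C_symm w v₀, hC1] at h1
      nlinarith
    have hd := discrim_le_zero hq
    rw [discrim, mul_zero, sub_zero] at hd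
    have : 2 * (A v₀ w - sInf S * C v₀ w) = 0 := by
      exact pow_eq_zero_iff (two_ne_zero) |>.1 (le_antisymm hd (sq_nonneg _))
    linarith
  refine ⟨v₀, sInf S, hrt, hC1, hCe, fun η => ?_⟩
  -- A general test vector is reduced to the complement by projection; the removed part contributes
  -- nothing because both forms vanish on `v₀` and `e i`.
  have hη := hvar (η - ∑ i, C η (e i) • e i) (fun i => by
    rw [map_sub, sub_apply, he.apply_sum, sub_self])
  have hAe : ∀ i, A v₀ (e i) = 0 := fun i => by
    rw [hF.A_symm, hs, hF.C_symm, hCe, mul_zero]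
  simpa [hAe, hCe] using hη

/-- As long as `m < j`, the span of `w` is too large for `m` orthogonality conditions to exclude
every nonzero vector, so it supplies a competitor for one more minimisation. -/
lemma IsFormPair.exists_orthonormal_eig [CompleteSpace H] [TopologicalSpace.SeparableSpace H]
    (hF : IsFormPair J γ M A C) (hγ : 0 < γ) (hinj : Function.Injective J)
    (hJ : IsCompletelyContinuous J) {j : ℕ} {w : Fin j → H} (hw : LinearIndependent ℝ w) {t : ℝ}
    (hR : RayleighBound A C t w) (m : ℕ) (hm : m ≤ j) :
    ∃ e : Fin m → H, IsOrthonormalFor C e ∧ ∀ i, ∃ r ≤ t, ∀ η, A (e i) η = r * C (e i) η := by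
  induction m with
  | zero => exact ⟨Fin.elim0, fun i => i.elim0, fun i => i.elim0⟩
  | succ m ih =>
    obtain ⟨e, he, hs⟩ := ih (by omega)
    choose s hst hs using hs
    let L : (Fin j → ℝ) →ₗ[ℝ] (Fin m → ℝ) :=
      LinearMap.pi fun k => ((C.flip (e k)).toLinearMap).comp (Fintype.linearCombination ℝ w)
    obtain ⟨c, hcL, hc0⟩ := Submodule.exists_mem_ne_zero_of_ne_bot
      (LinearMap.ker_ne_bot_of_finrank_lt (f := L) (by simpa using hm))
    have hcu : ∀ k, C (∑ i, c i • w i) (e k) = 0 := fun k => congrFun hcL k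
    have hu : ∑ i, c i • w i ≠ 0 := fun h => hc0 (funext (Fintype.linearIndependent_iff.1 hw c h))
    obtain ⟨v, r, hr, hv1, hve, hv⟩ := hF.exists_eig_of_rayleigh hγ hinj hJ he hs hu hcu (hR c)
    refine ⟨Fin.cons v e, ?_, ?_⟩
    · intro i k
      refine Fin.cases ?_ (fun i => ?_) i <;> refine Fin.cases ?_ (fun k => ?_) k
      · simpa using hv1
      · simpa [Fin.succ_ne_zero, (Fin.succ_ne_zero _).symm] using hve k
      · simpa [Fin.succ_ne_zero, hF.C_symm] using hve i
      · simpa using he i k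
    · refine Fin.cases ⟨r, hr, by simpa using hv⟩ (fun i => ⟨s i, hst i, by simpa using hs i⟩)

/-- Eigenvectors to different eigenvalues are `C`-orthogonal, so `t * C - A` at `∑ c i • w i` equals
`C` at the combination with coefficients `√(t - s i) * c i`. No orthogonality within an eigenspace
is needed. -/
lemma IsFormPair.rayleighBound_of_eig (hF : IsFormPair J γ M A C) (hγ : 0 < γ) {j : ℕ} {w : Fin j → H} {t : ℝ}
    (hw : ∀ i, ∃ s ≤ t, ∀ η, A (w i) η = s * C (w i) η) : RayleighBound A C t w := by
  choose s hst hs using hw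
  intro c
  set q : Fin j → ℝ := fun i => Real.sqrt (t - s i)
  have hCnn : ∀ v, 0 ≤ C v v := fun v => (by positivity : (0:ℝ) ≤ γ * ‖J v‖ ^ 2).trans (hF.C_lower v)
  have hcoef : ∀ i k, q i * q k * C (w i) (w k) = (t - s i) * C (w i) (w k) := by
    intro i k
    have h1 : s i * C (w i) (w k) = s k * C (w i) (w k) := by
      rw [← hs, hF.A_symm, hs, hF.C_symm]
    rcases mul_eq_mul_right_iff.1 h1 with h | h
    · have : q k = q i := by simp only [q, h]
      rw [this, Real.mul_self_sqrt (by linarith [hst i])]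
    · rw [h, mul_zero, mul_zero]
  have h := hCnn (∑ i, (q i * c i) • w i)
  have e1 : C (∑ i, (q i * c i) • w i) (∑ i, (q i * c i) • w i)
      = t * C (∑ i, c i • w i) (∑ i, c i • w i) - A (∑ i, c i • w i) (∑ i, c i • w i) := by
    simp only [map_sum, map_smul, sum_apply, smul_apply,
      smul_eq_mul, Finset.mul_sum, ← Finset.sum_sub_distrib]
    refine Finset.sum_congr rfl fun i _ => Finset.sum_congr rfl fun k _ => ?_
    have := hcoef k i
    rw [hs]
    linear_combination (c i * c k) * this
  linarith

/-- The min-max principle. It trades eigenvectors for trial subspaces, which can be transferred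
between different pairs of forms. -/
lemma IsFormPair.mem_eigSet_iff [CompleteSpace H] [TopologicalSpace.SeparableSpace H]
    (hF : IsFormPair J γ M A C) (hγ : 0 < γ) (hinj : Function.Injective J)
    (hJ : IsCompletelyContinuous J) {j : ℕ} {t : ℝ} :
    t ∈ eigSet A C j ↔ ∃ w : Fin j → H, LinearIndependent ℝ w ∧ RayleighBound A C t w := by
  constructor
  · rintro ⟨w, hw, hs⟩
    exact ⟨w, hw, hF.rayleighBound_of_eig hγ fun i => (hs i).imp fun s hs => ⟨hs.1, hs.2.2⟩⟩
  · rintro ⟨w, hw, hR⟩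
    obtain ⟨e, he, hs⟩ := hF.exists_orthonormal_eig hγ hinj hJ hw hR j le_rfl
    refine ⟨e, he.linearIndependent, fun i => ?_⟩
    obtain ⟨s, hst, hs⟩ := hs i
    exact ⟨s, hst, he.linearIndependent.ne_zero i, hs⟩

lemma IsFormPair.exists_orthonormal_of_mem [CompleteSpace H] [TopologicalSpace.SeparableSpace H]
    (hF : IsFormPair J γ M A C) (hγ : 0 < γ) (hinj : Function.Injective J)
    (hJ : IsCompletelyContinuous J) {j : ℕ} {t : ℝ} (ht : t ∈ eigSet A C j) :
    ∃ w : Fin j → H, IsOrthonormalFor C w ∧ RayleighBound A C t w := by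
  obtain ⟨w, hw, hR⟩ := (hF.mem_eigSet_iff hγ hinj hJ).1 ht
  obtain ⟨e, he, hs⟩ := hF.exists_orthonormal_eig hγ hinj hJ hw hR j le_rfl
  exact ⟨e, he, hF.rayleighBound_of_eig hγ hs⟩

lemma IsFormPair.nonneg_of_mem_eigSet (hF : IsFormPair J γ M A C) (hγ : 0 < γ)
    (hinj : Function.Injective J) {j : ℕ} (hj : 0 < j) {t : ℝ} (ht : t ∈ eigSet A C j) : 0 ≤ t := by
  obtain ⟨w, -, hs⟩ := ht
  obtain ⟨s, hst, hw0, hs⟩ := hs ⟨0, hj⟩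
  have h1 := hF.A_nonneg (w ⟨0, hj⟩)
  rw [hs] at h1
  exact (nonneg_of_mul_nonneg_left h1 (hF.C_pos hγ hinj hw0)).trans hst

end Single

end Abstract

/-! ### Convergence of eigenvalues and eigenvectors for converging forms -/

section AbstractConvergence

variable {H X : Type*} [NormedAddCommGroup H] [InnerProductSpace ℝ H]
  [NormedAddCommGroup X] [NormedSpace ℝ X]

lemma exists_weakTendsto_subseq_fin [CompleteSpace H] [TopologicalSpace.SeparableSpace H]
    {R : ℝ} (m : ℕ) (u : Fin m → ℕ → H) (hu : ∀ i n, ‖u i n‖ ≤ R) :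
    ∃ (u₀ : Fin m → H) (n : ℕ → ℕ), StrictMono n ∧
      ∀ i, WeakTendsto (fun k => u i (n k)) (u₀ i) := by
  induction m with
  | zero => exact ⟨Fin.elim0, id, strictMono_id, fun i => i.elim0⟩
  | succ m ih =>
    obtain ⟨v, n, hn, hv⟩ := ih (fun i => u i.succ) fun i => hu i.succ
    obtain ⟨v₀, p, hp, hv₀⟩ := exists_weakTendsto_subseq (u := fun k => u 0 (n k)) fun k => hu 0 _
    refine ⟨Fin.cons v₀ v, n ∘ p, hn.comp hp, fun i => ?_⟩
    refine Fin.cases ?_ (fun i => ?_) i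
    · exact hv₀
    · exact (hv i).comp hp

/-- An injective linear map from a finite-dimensional space is bounded below. Together with
`C_lower` this measures errors in the coefficients relative to `C`. -/
lemma exists_sum_sq_le {J : H →L[ℝ] X} (hinj : Function.Injective J) {m : ℕ} {w : Fin m → H}
    (hw : LinearIndependent ℝ w) :
    ∃ K : ℝ, 0 ≤ K ∧ ∀ c : Fin m → ℝ, ∑ i, c i ^ 2 ≤ K * ‖J (∑ i, c i • w i)‖ ^ 2 := by
  let L : EuclideanSpace ℝ (Fin m) →ₗ[ℝ] X :=
    (J.toLinearMap.comp (Fintype.linearCombination ℝ w)).comp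
      (WithLp.linearEquiv 2 ℝ (Fin m → ℝ)).toLinearMap
  have hL : LinearMap.ker L = ⊥ := by
    rw [LinearMap.ker_eq_bot]
    refine (hinj.comp ?_).comp (WithLp.linearEquiv 2 ℝ (Fin m → ℝ)).injective
    exact hw.fintypeLinearCombination_injective
  obtain ⟨K, -, hK⟩ := L.exists_antilipschitzWith hL
  refine ⟨(K : ℝ) ^ 2, by positivity, fun c => ?_⟩
  have h1 := hK.le_mul_dist (WithLp.toLp 2 c) 0
  rw [map_zero, dist_zero_right, dist_zero_right] at h1
  have h2 : L (WithLp.toLp 2 c) = J (∑ i, c i • w i) := rfl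
  rw [h2] at h1
  have h3 := pow_le_pow_left₀ (norm_nonneg _) h1 2
  rw [EuclideanSpace.norm_sq_eq, mul_pow] at h3
  simpa using h3

lemma abs_apply_sum_le (F : H →L[ℝ] H →L[ℝ] ℝ) {m : ℕ} (w : Fin m → H) (c : Fin m → ℝ) :
    |F (∑ i, c i • w i) (∑ i, c i • w i)| ≤ (∑ k, ∑ i, |F (w i) (w k)|) * ∑ i, c i ^ 2 := by
  simp only [map_sum, map_smul, sum_apply, smul_apply, smul_eq_mul, Finset.sum_mul]
  refine (Finset.abs_sum_le_sum_abs _ _).trans (Finset.sum_le_sum fun k _ => ?_)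
  rw [abs_mul, ← Finset.sum_mul, Finset.sum_mul]
  have hk : ∀ i, c i ^ 2 ≤ ∑ i, c i ^ 2 := fun i =>
    Finset.single_le_sum (f := fun i => c i ^ 2) (fun _ _ => sq_nonneg _) (Finset.mem_univ i)
  refine (mul_le_mul_of_nonneg_left (Finset.abs_sum_le_sum_abs _ _) (abs_nonneg _)).trans ?_
  rw [Finset.mul_sum]
  refine Finset.sum_le_sum fun i _ => ?_
  rw [abs_mul]
  have h1 : |c k| * |c i| ≤ ∑ i, c i ^ 2 := by
    have h2 := hk i
    have h3 := hk k
    rw [← sq_abs] at h2 h3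
    nlinarith [sq_nonneg (|c k| - |c i|)]
  calc |c k| * (|c i| * |F (w i) (w k)|) = |F (w i) (w k)| * (|c k| * |c i|) := by ring
    _ ≤ _ := by gcongr

lemma eigSet_mono {A C : H →L[ℝ] H →L[ℝ] ℝ} {j : ℕ} {s t : ℝ} (hst : s ≤ t)
    (hs : s ∈ eigSet A C j) : t ∈ eigSet A C j := by
  obtain ⟨w, hw, h⟩ := hs
  exact ⟨w, hw, fun i => (h i).imp fun r hr => ⟨hr.1.trans hst, hr.2⟩⟩

variable {J : H →L[ℝ] X} {γ M : ℝ}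

/-- On a fixed finite-dimensional span both `A` and `C` are comparable with the sum of squared
coefficients as far as needed, so some Rayleigh bound holds. -/
lemma IsFormPair.eigSet_nonempty [CompleteSpace H] [TopologicalSpace.SeparableSpace H]
    {A C : H →L[ℝ] H →L[ℝ] ℝ} (hF : IsFormPair J γ M A C) (hγ : 0 < γ)
    (hinj : Function.Injective J) (hJ : IsCompletelyContinuous J) {j : ℕ} {w : Fin j → H}
    (hw : LinearIndependent ℝ w) : (eigSet A C j).Nonempty := by
  obtain ⟨K, hK0, hK⟩ := exists_sum_sq_le hinj hw
  refine ⟨(∑ k, ∑ i, |A (w i) (w k)|) * (K / γ),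
    (hF.mem_eigSet_iff hγ hinj hJ).2 ⟨w, hw, fun c => ?_⟩⟩
  have h1 := hF.C_lower (∑ i, c i • w i)
  have h2 : ∑ i, c i ^ 2 ≤ K / γ * C (∑ i, c i • w i) (∑ i, c i • w i) := by
    refine (hK c).trans ?_
    rw [div_mul_eq_mul_div, le_div_iff₀ hγ]
    calc _ = K * (γ * ‖J (∑ i, c i • w i)‖ ^ 2) := by ring
      _ ≤ _ := by gcongr
  rw [mul_assoc]
  refine ((le_abs_self _).trans (abs_apply_sum_le A w c)).trans ?_
  gcongr

variable {A C : ℕ → H →L[ℝ] H →L[ℝ] ℝ} {A₀ C₀ : H →L[ℝ] H →L[ℝ] ℝ}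

/-- The pairs of forms `(A k, C k)` converge to `(A₀, C₀)`, with uniform bounds. -/
structure FormsTendsto (J : H →L[ℝ] X) (γ M : ℝ) (A C : ℕ → H →L[ℝ] H →L[ℝ] ℝ)
    (A₀ C₀ : H →L[ℝ] H →L[ℝ] ℝ) : Prop where
  pair : ∀ k, IsFormPair J γ M (A k) (C k)
  limit : IsFormPair J γ M A₀ C₀
  tendsto_A : ∀ v, Tendsto (fun k => A k v) atTop (𝓝 (A₀ v))
  tendsto_C : ∀ v, Tendsto (fun k => C k v) atTop (𝓝 (C₀ v))

lemma FormsTendsto.comp (h : FormsTendsto J γ M A C A₀ C₀) {n : ℕ → ℕ} (hn : StrictMono n) :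
    FormsTendsto J γ M (fun k => A (n k)) (fun k => C (n k)) A₀ C₀ where
  pair k := h.pair (n k)
  limit := h.limit
  tendsto_A v := (h.tendsto_A v).comp hn.tendsto_atTop
  tendsto_C v := (h.tendsto_C v).comp hn.tendsto_atTop

/-- The compactness half. Families are taken orthonormal for `C k`, so that they are bounded and so
that independence, which weak limits could destroy, survives as orthonormality for `C₀`. -/
lemma FormsTendsto.mem_eigSet_of_tendsto [CompleteSpace H] [TopologicalSpace.SeparableSpace H]
    (h : FormsTendsto J γ M A C A₀ C₀) (hγ : 0 < γ)
    (hinj : Function.Injective J) (hJ : IsCompletelyContinuous J) {j : ℕ} {t : ℕ → ℝ} {t₀ : ℝ}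
    (ht : Tendsto t atTop (𝓝 t₀)) (hmem : ∀ k, t k ∈ eigSet (A k) (C k) j) :
    t₀ ∈ eigSet A₀ C₀ j := by
  choose w hw hR using fun k => (h.pair k).exists_orthonormal_of_mem hγ hinj hJ (hmem k)
  obtain ⟨T, hT⟩ := ht.bddAbove_range
  have hT : ∀ k, t k ≤ T := fun k => hT ⟨k, rfl⟩
  have hbd : ∀ i k, ‖w k i‖ ≤ Real.sqrt ((T + 1) / γ) := by
    intro i k
    refine (h.pair k).norm_le hγ ?_
    -- The Rayleigh bound on a single basis vector gives `A ≤ t k ≤ T`; adding `C = 1` yields `T +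
    -- 1`.
    have h1 := hR k (Pi.single i 1)
    have h2 : ∑ l, (Pi.single i 1 : Fin j → ℝ) l • w k l = w k i := by
      simp [Pi.single_apply]
    rw [h2] at h1
    have h3 : C k (w k i) (w k i) = 1 := by simp [hw k i i]
    rw [h3] at h1 ⊢
    linarith [hT k]
  obtain ⟨v, n, hn, hv⟩ := exists_weakTendsto_subseq_fin j (fun i k => w k i) hbd
  have h' := h.comp hn
  have hvo : IsOrthonormalFor C₀ v := by
    intro i l
    have h1 := PhaseFieldEigen.tendsto_C hJ h'.pair h'.tendsto_C (fun k => hbd i (n k))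
      (fun k => hbd l (n k)) (hv i) (hv l)
    simp only [hw _ i l] at h1
    exact tendsto_nhds_unique h1 tendsto_const_nhds
  refine (h.limit.mem_eigSet_iff hγ hinj hJ).2 ⟨v, hvo.linearIndependent, fun c => ?_⟩
  have hws := WeakTendsto.sum_smul hv c
  have hbs : ∀ k, ‖∑ i, c i • w (n k) i‖ ≤ ∑ i, |c i| * Real.sqrt ((T + 1) / γ) := by
    intro k
    refine norm_sum_le_of_le _ fun i _ => ?_
    rw [norm_smul, Real.norm_eq_abs]
    gcongr
    exact hbd i _
  refine lsc_A h'.pair h'.tendsto_A hbs hws ?_ (fun k => hR (n k) c)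
  exact (ht.comp hn.tendsto_atTop).mul
    (PhaseFieldEigen.tendsto_C hJ h'.pair h'.tendsto_C hbs hbs hws hws)

/-- The trial family of the limit is kept. On its span the errors of both forms are eventually a
small multiple of `C p`, uniformly in the coefficients, and `ε` absorbs them. -/
lemma FormsTendsto.eventually_mem_eigSet [CompleteSpace H] [TopologicalSpace.SeparableSpace H]
    (h : FormsTendsto J γ M A C A₀ C₀) (hγ : 0 < γ)
    (hinj : Function.Injective J) (hJ : IsCompletelyContinuous J) {j : ℕ} {t ε : ℝ}
    (hε : 0 < ε) (ht : t ∈ eigSet A₀ C₀ j) : ∀ᶠ k in atTop, t + ε ∈ eigSet (A k) (C k) j := by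
  obtain ⟨w, hw, hR⟩ := (h.limit.mem_eigSet_iff hγ hinj hJ).1 ht
  obtain ⟨K, hK0, hK⟩ := exists_sum_sq_le hinj hw
  have hlim : ∀ {F : ℕ → H →L[ℝ] H →L[ℝ] ℝ} {F₀ : H →L[ℝ] H →L[ℝ] ℝ},
      (∀ v, Tendsto (fun k => F k v) atTop (𝓝 (F₀ v))) →
      Tendsto (fun p => ∑ k, ∑ i, |(F p - F₀) (w i) (w k)|) atTop (𝓝 0) := by
    intro F F₀ hF
    have : (0 : ℝ) = ∑ k : Fin j, ∑ i : Fin j, |(0 : ℝ)| := by simp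
    rw [this]
    refine tendsto_finsetSum _ fun k _ => tendsto_finsetSum _ fun i _ => Tendsto.abs ?_
    have h1 := ((ContinuousLinearMap.apply ℝ ℝ (w k)).continuous.tendsto _).comp (hF (w i))
    simpa using h1.sub_const (F₀ (w i) (w k))
  have hsmall : Tendsto (fun p => ((∑ k, ∑ i, |(A p - A₀) (w i) (w k)|)
      + |t| * (∑ k, ∑ i, |(C p - C₀) (w i) (w k)|)) * (K / γ)) atTop (𝓝 0) := by
    simpa using ((hlim h.tendsto_A).add ((hlim h.tendsto_C).const_mul |t|)).mul_const (K / γ)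
  filter_upwards [hsmall.eventually_lt_const hε] with p hp
  refine ((h.pair p).mem_eigSet_iff hγ hinj hJ).2 ⟨w, hw, fun c => ?_⟩
  set u := ∑ i, c i • w i
  set S := ∑ i, c i ^ 2
  set α := ∑ k, ∑ i, |(A p - A₀) (w i) (w k)|
  set β := ∑ k, ∑ i, |(C p - C₀) (w i) (w k)|
  have hα : 0 ≤ α := Finset.sum_nonneg fun _ _ => Finset.sum_nonneg fun _ _ => abs_nonneg _
  have hβ : 0 ≤ β := Finset.sum_nonneg fun _ _ => Finset.sum_nonneg fun _ _ => abs_nonneg _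
  have h1 : |A p u u - A₀ u u| ≤ α * S := abs_apply_sum_le (A p - A₀) w c
  have h2 : |C p u u - C₀ u u| ≤ β * S := abs_apply_sum_le (C p - C₀) w c
  have h3 : A₀ u u ≤ t * C₀ u u := hR c
  -- The constant is independent of `p` because `C_lower` holds with the same `γ` for all pairs.
  have h4 : S ≤ K / γ * C p u u := by
    refine (hK c).trans ?_
    rw [div_mul_eq_mul_div, le_div_iff₀ hγ]
    calc _ = K * (γ * ‖J u‖ ^ 2) := by ring
      _ ≤ _ := by gcongr; exact (h.pair p).C_lower u
  have h5 : 0 ≤ C p u u :=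
    (by positivity : (0 : ℝ) ≤ γ * ‖J u‖ ^ 2).trans ((h.pair p).C_lower u)
  have h6 : t * C₀ u u ≤ t * C p u u + |t| * (β * S) := by
    have : t * (C₀ u u - C p u u) ≤ |t| * (β * S) := by
      refine (le_abs_self _).trans ?_
      rw [abs_mul, abs_sub_comm]
      gcongr
    linarith
  have h7 : (α + |t| * β) * S ≤ (α + |t| * β) * (K / γ * C p u u) := by gcongr
  have h8 : (α + |t| * β) * (K / γ) * C p u u ≤ ε * C p u u := by gcongr
  have h9 := (abs_le.1 h1).2
  calc A p u u ≤ t * C p u u + (α + |t| * β) * S := by linarith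
    _ ≤ t * C p u u + ε * C p u u := by linarith
    _ = _ := by ring

/-- Convergence of the eigenvalues. -/
theorem FormsTendsto.tendsto_sInf_eigSet [CompleteSpace H] [TopologicalSpace.SeparableSpace H]
    (h : FormsTendsto J γ M A C A₀ C₀) (hγ : 0 < γ)
    (hinj : Function.Injective J) (hJ : IsCompletelyContinuous J) {j : ℕ} (hj : 0 < j)
    {w : Fin j → H} (hw : LinearIndependent ℝ w) :
    Tendsto (fun k => sInf (eigSet (A k) (C k) j)) atTop (𝓝 (sInf (eigSet A₀ C₀ j))) := by
  have hbdd : ∀ {A C : H →L[ℝ] H →L[ℝ] ℝ}, IsFormPair J γ M A C → BddBelow (eigSet A C j) :=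
    fun hF => ⟨0, fun t ht => hF.nonneg_of_mem_eigSet hγ hinj hj ht⟩
  refine tendsto_order.2 ⟨fun a ha => ?_, fun a ha => ?_⟩
  -- Otherwise infinitely many infima are at most `a`. A `t` strictly between `a` and the limit
  -- infimum then lies in all those sets, hence in the limit set.
  · by_contra hcon
    obtain ⟨n, hn, hna⟩ := extraction_of_frequently_atTop (not_eventually.1 hcon)
    obtain ⟨t, hat, ht⟩ := exists_between ha
    have hmem : ∀ k, t ∈ eigSet (A (n k)) (C (n k)) j := by
      intro k
      obtain ⟨s, hs, hst⟩ := exists_lt_of_csInf_lt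
        ((h.pair (n k)).eigSet_nonempty hγ hinj hJ hw) ((not_lt.1 (hna k)).trans_lt hat)
      exact eigSet_mono hst.le hs
    exact absurd (csInf_le (hbdd h.limit) ((h.comp hn).mem_eigSet_of_tendsto hγ hinj hJ
      tendsto_const_nhds hmem)) (not_le.2 ht)
  · obtain ⟨t, ht, hta⟩ := exists_lt_of_csInf_lt (h.limit.eigSet_nonempty hγ hinj hJ hw) ha
    filter_upwards [h.eventually_mem_eigSet hγ hinj hJ (half_pos (sub_pos.2 hta)) ht] with k hk
    exact (csInf_le (hbdd (h.pair k)) hk).trans_lt (by linarith)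

/-- Closedness of the set, from the compactness half applied to constant sequences of forms. Hence
the infimum is attained. -/
lemma IsFormPair.sInf_mem_eigSet [CompleteSpace H] [TopologicalSpace.SeparableSpace H]
    (h : IsFormPair J γ M A₀ C₀) (hγ : 0 < γ)
    (hinj : Function.Injective J) (hJ : IsCompletelyContinuous J) {j : ℕ} (hj : 0 < j)
    {w : Fin j → H} (hw : LinearIndependent ℝ w) : sInf (eigSet A₀ C₀ j) ∈ eigSet A₀ C₀ j := by
  obtain ⟨u, -, -, hu, hmem⟩ := (isGLB_csInf (h.eigSet_nonempty hγ hinj hJ hw)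
    ⟨0, fun t ht => h.nonneg_of_mem_eigSet hγ hinj hj ht⟩).exists_seq_antitone_tendsto
    (h.eigSet_nonempty hγ hinj hJ hw)
  exact FormsTendsto.mem_eigSet_of_tendsto (A := fun _ => A₀) (C := fun _ => C₀)
    ⟨fun _ => h, h, fun _ => tendsto_const_nhds, fun _ => tendsto_const_nhds⟩ hγ hinj hJ hu hmem

/-- Normalized eigenvectors converge along a subsequence to a normalized eigenvector. -/
theorem FormsTendsto.exists_subseq_eig [CompleteSpace H] [TopologicalSpace.SeparableSpace H]
    (h : FormsTendsto J γ M A C A₀ C₀) (hγ : 0 < γ) (hJ : IsCompletelyContinuous J)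
    {t : ℕ → ℝ} {t₀ : ℝ} (ht : Tendsto t atTop (𝓝 t₀)) {u : ℕ → H}
    (hu : ∀ k, IsEig (A k) (C k) (t k) (u k)) (hu1 : ∀ k, C k (u k) (u k) = 1) :
    ∃ (v : H) (n : ℕ → ℕ), StrictMono n ∧ IsEig A₀ C₀ t₀ v ∧ C₀ v v = 1 ∧
      WeakTendsto (fun k => u (n k)) v ∧ Tendsto (fun k => J (u (n k))) atTop (𝓝 (J v)) := by
  obtain ⟨T, hT⟩ := ht.bddAbove_range
  have hT : ∀ k, t k ≤ T := fun k => hT ⟨k, rfl⟩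
  have hbd : ∀ k, ‖u k‖ ≤ Real.sqrt ((T + 1) / γ) := by
    intro k
    refine (h.pair k).norm_le hγ ?_
    rw [(hu k).2, hu1]
    linarith [hT k]
  obtain ⟨v, n, hn, hv⟩ := exists_weakTendsto_subseq hbd
  have h' := h.comp hn
  have hb' := fun k => hbd (n k)
  have hv1 : C₀ v v = 1 := by
    have h1 := PhaseFieldEigen.tendsto_C hJ h'.pair h'.tendsto_C hb' hb' hv hv
    simp only [hu1] at h1
    exact tendsto_nhds_unique h1 tendsto_const_nhds
  refine ⟨v, n, hn, ⟨?_, fun η => ?_⟩, hv1, hv, hJ _ _ _ hb' hv⟩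
  · rintro rfl
    simp at hv1
  -- By symmetry the fixed `η` takes the left slot, so norm-convergent functionals meet the weakly
  -- convergent `u`.
  · have h1 := hv.apply_tendsto hb' (h'.tendsto_A η)
    have h2 := (ht.comp hn.tendsto_atTop).mul (hv.apply_tendsto hb' (h'.tendsto_C η))
    rw [h.limit.A_symm, h.limit.C_symm v]
    refine tendsto_nhds_unique h1 (h2.congr fun k => ?_)
    rw [(h.pair (n k)).A_symm, (hu (n k)).2, (h.pair (n k)).C_symm]
    rfl

end AbstractConvergence

/-! ### Multiplication operators on `L²` and their forms -/

section Multiplication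

variable {α E : Type*} [MeasurableSpace α] {μ : Measure α} [NormedAddCommGroup E]
  [InnerProductSpace ℝ E]

lemma memLp_smul_of_bdd {m : α → ℝ} {M : ℝ} (hm : AEStronglyMeasurable m μ)
    (hM : ∀ᵐ x ∂μ, |m x| ≤ M) (U : Lp E 2 μ) : MemLp (fun x => m x • U x) 2 μ := by
  refine (Lp.memLp U).of_le_mul (c := M) (hm.smul (Lp.aestronglyMeasurable U)) ?_
  filter_upwards [hM] with x hx
  rw [norm_smul, Real.norm_eq_abs]
  gcongr

/-- Multiplication by a bounded function as an operator on `L²`. -/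
noncomputable def mulCLM {m : α → ℝ} {M : ℝ} (hm : AEStronglyMeasurable m μ)
    (hM : ∀ᵐ x ∂μ, |m x| ≤ M) : Lp E 2 μ →L[ℝ] Lp E 2 μ :=
  LinearMap.mkContinuous
    { toFun := fun U => (memLp_smul_of_bdd hm hM U).toLp
      map_add' := fun U V => by
        ext1
        filter_upwards [(memLp_smul_of_bdd hm hM (U + V)).coeFn_toLp,
          (memLp_smul_of_bdd hm hM U).coeFn_toLp, (memLp_smul_of_bdd hm hM V).coeFn_toLp,
          Lp.coeFn_add U V, Lp.coeFn_add (memLp_smul_of_bdd hm hM U).toLp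
            (memLp_smul_of_bdd hm hM V).toLp] with x h1 h2 h3 h4 h5
        rw [h1, h5, Pi.add_apply, h2, h3, h4, Pi.add_apply, smul_add]
      map_smul' := fun t U => by
        ext1
        filter_upwards [(memLp_smul_of_bdd hm hM (t • U)).coeFn_toLp,
          (memLp_smul_of_bdd hm hM U).coeFn_toLp, Lp.coeFn_smul t U,
          Lp.coeFn_smul t (memLp_smul_of_bdd hm hM U).toLp] with x h1 h2 h3 h4
        rw [RingHom.id_apply, h1, h4, Pi.smul_apply, h2, h3, Pi.smul_apply, smul_comm] }
    M fun U => by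
      refine Lp.norm_le_mul_norm_of_ae_le_mul ?_
      filter_upwards [(memLp_smul_of_bdd hm hM U).coeFn_toLp, hM] with x hx hMx
      simp only [LinearMap.coe_mk, AddHom.coe_mk]
      rw [hx, norm_smul, Real.norm_eq_abs]
      gcongr

lemma mulCLM_coeFn {m : α → ℝ} {M : ℝ} (hm : AEStronglyMeasurable m μ)
    (hM : ∀ᵐ x ∂μ, |m x| ≤ M) (U : Lp E 2 μ) : mulCLM hm hM U =ᵐ[μ] fun x => m x • U x :=
  (memLp_smul_of_bdd hm hM U).coeFn_toLp

lemma L2_norm_sq_eq (U : Lp E 2 μ) : ‖U‖ ^ 2 = ∫ x, ‖U x‖ ^ 2 ∂μ := by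
  rw [← real_inner_self_eq_norm_sq, L2.inner_def]
  simp only [real_inner_self_eq_norm_sq]

lemma L2_integrable_norm_sq (U : Lp E 2 μ) : Integrable (fun x => ‖U x‖ ^ 2) μ := by
  have := L2.integrable_inner (𝕜 := ℝ) U U
  simpa only [real_inner_self_eq_norm_sq] using this

/-- Dominated convergence with majorant `(2 * M) ^ 2 * ‖U x‖ ^ 2`. Almost everywhere convergence of
the multipliers gives this for each fixed `U`, not in operator norm. -/
lemma tendsto_mulCLM {m : ℕ → α → ℝ} {m₀ : α → ℝ} {M : ℝ}
    (hm : ∀ k, AEStronglyMeasurable (m k) μ) (hm₀ : AEStronglyMeasurable m₀ μ)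
    (hM : ∀ k, ∀ᵐ x ∂μ, |m k x| ≤ M) (hM₀ : ∀ᵐ x ∂μ, |m₀ x| ≤ M)
    (hlim : ∀ᵐ x ∂μ, Tendsto (fun k => m k x) atTop (𝓝 (m₀ x))) (U : Lp E 2 μ) :
    Tendsto (fun k => mulCLM (hm k) (hM k) U) atTop (𝓝 (mulCLM hm₀ hM₀ U)) := by
  rw [tendsto_iff_norm_sub_tendsto_zero]
  have hsq : Tendsto (fun k => ‖mulCLM (hm k) (hM k) U - mulCLM hm₀ hM₀ U‖ ^ 2) atTop (𝓝 0) := by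
    have hpt : ∀ k, (fun x => ‖(mulCLM (hm k) (hM k) U - mulCLM hm₀ hM₀ U) x‖ ^ 2) =ᵐ[μ]
        fun x => |m k x - m₀ x| ^ 2 * ‖U x‖ ^ 2 := fun k => by
      filter_upwards [Lp.coeFn_sub (mulCLM (hm k) (hM k) U) (mulCLM hm₀ hM₀ U),
        mulCLM_coeFn (hm k) (hM k) U, mulCLM_coeFn hm₀ hM₀ U] with x h1 h2 h3
      rw [h1, Pi.sub_apply, h2, h3, ← sub_smul, norm_smul, mul_pow, Real.norm_eq_abs]
    simp only [L2_norm_sq_eq, integral_congr_ae (hpt _)]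
    have h0 : (0 : ℝ) = ∫ x, (0 : ℝ) ∂μ := by simp
    rw [h0]
    refine tendsto_integral_of_dominated_convergence (fun x => (M + M) ^ 2 * ‖U x‖ ^ 2)
      (fun k => ?_) ((L2_integrable_norm_sq U).const_mul _) (fun k => ?_) ?_
    · exact (L2_integrable_norm_sq _).aestronglyMeasurable.congr (hpt k)
    · filter_upwards [hM k, hM₀] with x h1 h2
      rw [Real.norm_of_nonneg (by positivity)]
      gcongr
      exact (abs_sub _ _).trans (add_le_add h1 h2)
    · filter_upwards [hlim] with x hx
      have := (((hx.sub_const (m₀ x)).abs).pow 2).mul_const (‖U x‖ ^ 2)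
      simpa using this
  have := hsq.sqrt
  simpa using this

/-- The bounded bilinear form `(U, V) ↦ ∫ m ⟨U, V⟩`. -/
noncomputable def mulForm {m : α → ℝ} {M : ℝ} (hm : AEStronglyMeasurable m μ)
    (hM : ∀ᵐ x ∂μ, |m x| ≤ M) : Lp E 2 μ →L[ℝ] Lp E 2 μ →L[ℝ] ℝ :=
  (innerSL ℝ).comp (mulCLM hm hM)

lemma mulForm_apply {m : α → ℝ} {M : ℝ} (hm : AEStronglyMeasurable m μ)
    (hM : ∀ᵐ x ∂μ, |m x| ≤ M) (U V : Lp E 2 μ) :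
    mulForm hm hM U V = ∫ x, m x * inner ℝ (U x) (V x) ∂μ := by
  have : mulForm hm hM U V = inner ℝ (mulCLM hm hM U) V := rfl
  rw [this, L2.inner_def]
  refine integral_congr_ae ?_
  filter_upwards [mulCLM_coeFn hm hM U] with x hx
  rw [hx, real_inner_smul_left]

lemma mulForm_symm {m : α → ℝ} {M : ℝ} (hm : AEStronglyMeasurable m μ)
    (hM : ∀ᵐ x ∂μ, |m x| ≤ M) (U V : Lp E 2 μ) : mulForm hm hM U V = mulForm hm hM V U := by
  simp only [mulForm_apply, real_inner_comm]

lemma abs_mulForm_le {m : α → ℝ} {M : ℝ} (hm : AEStronglyMeasurable m μ)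
    (hM : ∀ᵐ x ∂μ, |m x| ≤ M) (U V : Lp E 2 μ) : |mulForm hm hM U V| ≤ M * ‖U‖ * ‖V‖ := by
  refine (abs_real_inner_le_norm (mulCLM hm hM U) V).trans ?_
  gcongr
  refine Lp.norm_le_mul_norm_of_ae_le_mul ?_
  filter_upwards [mulCLM_coeFn hm hM U, hM] with x hx hMx
  rw [hx, norm_smul, Real.norm_eq_abs]
  gcongr

lemma le_mulForm {m : α → ℝ} {M γ : ℝ} (hm : AEStronglyMeasurable m μ)
    (hM : ∀ᵐ x ∂μ, |m x| ≤ M) (hγ : ∀ᵐ x ∂μ, γ ≤ m x) (U : Lp E 2 μ) :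
    γ * ‖U‖ ^ 2 ≤ mulForm hm hM U U := by
  rw [L2_norm_sq_eq, mulForm_apply, ← integral_const_mul]
  refine integral_mono_ae ((L2_integrable_norm_sq U).const_mul _) ?_ ?_
  · refine (L2.integrable_inner (𝕜 := ℝ) (mulCLM hm hM U) U).congr ?_
    filter_upwards [mulCLM_coeFn hm hM U] with x hx
    rw [hx, real_inner_smul_left]
  · filter_upwards [hγ] with x hx
    rw [real_inner_self_eq_norm_sq]
    gcongr

lemma tendsto_mulForm {m : ℕ → α → ℝ} {m₀ : α → ℝ} {M : ℝ}
    (hm : ∀ k, AEStronglyMeasurable (m k) μ) (hm₀ : AEStronglyMeasurable m₀ μ)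
    (hM : ∀ k, ∀ᵐ x ∂μ, |m k x| ≤ M) (hM₀ : ∀ᵐ x ∂μ, |m₀ x| ≤ M)
    (hlim : ∀ᵐ x ∂μ, Tendsto (fun k => m k x) atTop (𝓝 (m₀ x))) (U : Lp E 2 μ) :
    Tendsto (fun k => mulForm (hm k) (hM k) U) atTop (𝓝 (mulForm hm₀ hM₀ U)) :=
  ((innerSL ℝ).continuous.tendsto _).comp (tendsto_mulCLM hm hm₀ hM hM₀ hlim U)

end Multiplication

/-! ### The Hilbert space `H¹` and its embedding into `L²` -/

section Sobolev

variable {d : ℕ} {Ω : Set (Euc d)}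

instance instFactTwoNeTop : Fact ((2 : ℝ≥0∞) ≠ ⊤) := ⟨by simp⟩

/-- The embedding of `H¹(Ω)` into `L²(Ω)`. -/
noncomputable def toL2L (Ω : Set (Euc d)) : H1 Ω →L[ℝ] L2 Ω :=
  (WithLp.fstL 2 ℝ (L2 Ω) (L2Vec Ω)).comp (H1 Ω).subtypeL

/-- The weak gradient as an operator. -/
noncomputable def wgradL (Ω : Set (Euc d)) : H1 Ω →L[ℝ] L2Vec Ω :=
  (WithLp.sndL 2 ℝ (L2 Ω) (L2Vec Ω)).comp (H1 Ω).subtypeL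

@[simp] lemma toL2L_apply (u : H1 Ω) : toL2L Ω u = toL2 u := rfl

lemma H1_norm_sq (u : H1 Ω) : ‖u‖ ^ 2 = ‖toL2 u‖ ^ 2 + ‖wgrad u‖ ^ 2 :=
  WithLp.prod_norm_sq_eq_of_L2 (u : WithLp 2 (L2 Ω × L2Vec Ω))

lemma isWeakGradient_wgrad (u : H1 Ω) : IsWeakGradient Ω (toL2 u) (wgrad u) := u.2

instance instSecondCountableWithLp :
    SecondCountableTopology (WithLp 2 (L2 Ω × L2Vec Ω)) := by
  have h1 : SecondCountableTopology (L2 Ω) := Lp.SecondCountableTopology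
  have h2 : SecondCountableTopology (L2Vec Ω) := Lp.SecondCountableTopology
  exact (WithLp.homeomorphProd 2 (L2 Ω) (L2Vec Ω)).secondCountableTopology

instance instSeparableH1 : TopologicalSpace.SeparableSpace (H1 Ω) := by
  have : SecondCountableTopology (H1 Ω) := TopologicalSpace.Subtype.secondCountableTopology _
  infer_instance

instance instSeparableH10 : TopologicalSpace.SeparableSpace (H10 Ω) := by
  have : SecondCountableTopology (H1 Ω) := TopologicalSpace.Subtype.secondCountableTopology _
  have : SecondCountableTopology (H10 Ω) := TopologicalSpace.Subtype.secondCountableTopology _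
  infer_instance

lemma IsTestFunction.memLp_smul_const {η : Euc d → ℝ} (hη : IsTestFunction Ω η) (v : Euc d) :
    MemLp (fun x => η x • v) 2 (volume.restrict Ω) :=
  (hη.smooth.continuous.smul continuous_const).memLp_of_hasCompactSupport hη.compact.smul_right

/-- Each test function and direction imposes one equation between `L²` inner products with fixed
functions, so the space is an intersection of closed sets. -/
lemma isClosed_H1 : IsClosed (H1 Ω : Set (WithLp 2 (L2 Ω × L2Vec Ω))) := by
  have : (H1 Ω : Set (WithLp 2 (L2 Ω × L2Vec Ω))) = ⋂ (η : Euc d → ℝ) (hη : IsTestFunction Ω η)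
      (v : Euc d), {p | inner ℝ (MemLp.toLp (fun x => fderiv ℝ η x v) (hη.memLp_fderiv v)) (WithLp.fstL 2 ℝ (L2 Ω) (L2Vec Ω) p)
        = - inner ℝ (MemLp.toLp (fun x => η x • v) (hη.memLp_smul_const v)) (WithLp.sndL 2 ℝ (L2 Ω) (L2Vec Ω) p)} := by
    ext p
    simp only [Set.mem_iInter, Set.mem_ofPred_eq, L2.inner_def]
    refine forall_congr' fun η => forall_congr' fun hη => forall_congr' fun v => ?_
    have e1 : ∫ x in Ω, inner ℝ (MemLp.toLp (fun x => fderiv ℝ η x v) (hη.memLp_fderiv v) x) (p.fst x)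
        = ∫ x in Ω, p.fst x * fderiv ℝ η x v := by
      refine integral_congr_ae ?_
      filter_upwards [(hη.memLp_fderiv v).coeFn_toLp] with x hx
      rw [hx]; simp
    have e2 : ∫ x in Ω, inner ℝ (MemLp.toLp (fun x => η x • v) (hη.memLp_smul_const v) x) (p.snd x)
        = ∫ x in Ω, (inner ℝ (p.snd x) v : ℝ) * η x := by
      refine integral_congr_ae ?_
      filter_upwards [(hη.memLp_smul_const v).coeFn_toLp] with x hx
      rw [hx, real_inner_smul_left, real_inner_comm, mul_comm]
    exact Eq.congr e1.symm (congrArg Neg.neg e2.symm)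
  rw [this]
  refine isClosed_iInter fun η => isClosed_iInter fun hη => isClosed_iInter fun v =>
    isClosed_eq ?_ ?_
  · exact continuous_const.inner (ContinuousLinearMap.continuous _)
  · exact (continuous_const.inner (ContinuousLinearMap.continuous _)).neg

instance instCompleteH1 : CompleteSpace (H1 Ω) := isClosed_H1.completeSpace_coe

instance instCompleteH10 : CompleteSpace (H10 Ω) :=
  (Submodule.isClosed_topologicalClosure _).completeSpace_coe

lemma locallyIntegrableOn_of_memLp {E : Type*} [NormedAddCommGroup E] {f : Euc d → E}
    (hf : MemLp f 2 (volume.restrict Ω)) : LocallyIntegrableOn f Ω := by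
  refine (locallyIntegrableOn_of_locallyIntegrable_restrict ?_)
  exact hf.locallyIntegrable (by norm_num)

/-- The gradient is a separate component of the pair; if the function vanishes, every directional
component integrates to zero against test functions and so vanishes too. -/
lemma toL2_injective (hΩ : IsOpen Ω) : Function.Injective (toL2L Ω) := by
  rw [injective_iff_map_eq_zero]
  intro u hu
  have hG : wgrad u = 0 := by
    rw [Lp.eq_zero_iff_ae_eq_zero]
    refine ae_eq_zero_of_forall_inner (𝕜 := ℝ) fun v => ?_
    have := hΩ.ae_eq_zero_of_integral_contDiff_smul_eq_zero (μ := volume)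
      (f := fun x => inner ℝ v (wgrad u x))
      (locallyIntegrableOn_of_memLp ((Lp.memLp (wgrad u)).const_inner v)) (by
        intro η h1 h2 h3
        have h4 := isWeakGradient_wgrad u η ⟨h1, h2, h3⟩ v
        have h5 : ∫ x in Ω, toL2 u x * fderiv ℝ η x v = 0 := by
          rw [show toL2 u = 0 from hu]
          rw [integral_eq_zero_of_ae]
          filter_upwards [Lp.coeFn_zero ℝ 2 (volume.restrict Ω)] with x hx
          rw [hx]; simp
        rw [h5] at h4
        rw [← setIntegral_eq_integral_of_forall_compl_eq_zero (s := Ω)]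
        · rw [zero_eq_neg] at h4
          rw [← h4]
          refine integral_congr_ae (ae_of_all _ fun x => ?_)
          simp only [smul_eq_mul]
          rw [mul_comm, real_inner_comm]
        · intro x hx
          rw [image_eq_zero_of_notMem_tsupport fun h => hx (h3 h), zero_smul])
    exact (ae_restrict_iff' hΩ.measurableSet).2 this
  have h := H1_norm_sq u
  rw [hG, show toL2 u = 0 from hu] at h
  simpa using h

/-- Smooth functions that are square integrable together with their gradient belong to `H¹(Ω)`. -/
lemma exists_H1_of_contDiff {f : Euc d → ℝ} (hf : ContDiff ℝ 1 f)
    (hf2 : MemLp f 2 (volume.restrict Ω)) (hg2 : MemLp (gradient f) 2 (volume.restrict Ω)) :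
    ∃ u : H1 Ω, toL2 u =ᵐ[volume.restrict Ω] f ∧ wgrad u =ᵐ[volume.restrict Ω] gradient f := by
  refine ⟨⟨WithLp.toLp 2 (hf2.toLp, hg2.toLp), ?_⟩, hf2.coeFn_toLp, hg2.coeFn_toLp⟩
  intro η hη v
  -- The support of `η` lies in `Ω`, so both integrals extend to the whole space, where integration
  -- by parts has no boundary term.
  have e1 : ∫ x in Ω, hf2.toLp f x * fderiv ℝ η x v = ∫ x, f x * fderiv ℝ η x v := by
    refine Eq.trans ?_ (setIntegral_eq_integral_of_forall_compl_eq_zero (s := Ω) ?_)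
    · refine integral_congr_ae ?_
      filter_upwards [hf2.coeFn_toLp] with x hx
      rw [hx]
    · intro x hx
      have : x ∉ tsupport (fderiv ℝ η) := fun h => hx (hη.supp (tsupport_fderiv_subset ℝ h))
      rw [image_eq_zero_of_notMem_tsupport this]
      simp
  have e2 : ∫ x in Ω, (inner ℝ (hg2.toLp _ x) v : ℝ) * η x = ∫ x, fderiv ℝ f x v * η x := by
    refine Eq.trans ?_ (setIntegral_eq_integral_of_forall_compl_eq_zero (s := Ω) ?_)
    · refine integral_congr_ae ?_
      filter_upwards [hg2.coeFn_toLp] with x hx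
      rw [hx, inner_gradient_left]
    · intro x hx
      rw [image_eq_zero_of_notMem_tsupport fun h => hx (hη.supp h), mul_zero]
  refine e1.trans (Eq.trans ?_ (congrArg Neg.neg e2).symm)
  have hcf : Continuous fun x => fderiv ℝ f x v :=
    (hf.continuous_fderiv (by simp)).clm_apply continuous_const
  have hcη : Continuous fun x => fderiv ℝ η x v :=
    (hη.smooth.continuous_fderiv (by simp)).clm_apply continuous_const
  refine integral_mul_fderiv_eq_neg_fderiv_mul_of_integrable ?_ ?_ ?_
    (fun x _ => hf.differentiable (by simp) x) (fun x _ => hη.smooth.differentiable (by simp) x)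
  · exact (hcf.mul hη.smooth.continuous).integrable_of_hasCompactSupport hη.compact.mul_left
  · exact (hf.continuous.mul hcη).integrable_of_hasCompactSupport
      (hη.compact.fderiv_apply (𝕜 := ℝ) v).mul_left
  · exact (hf.continuous.mul hη.smooth.continuous).integrable_of_hasCompactSupport
      hη.compact.mul_left

end Sobolev

/-! ### The cone condition and translation estimates -/

section Translation

variable {d : ℕ} {Ω V : Set (Euc d)}

/-- A local cone condition: near each point of the closure of a Lipschitz domain there are balls of
arbitrarily short vectors that point into the domain. -/
lemma IsBoundedLipschitzDomain.exists_cone (hΩ : IsBoundedLipschitzDomain Ω) {x₀ : Euc d}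
    (hx₀ : x₀ ∈ closure Ω) :
    ∃ r > 0, ∀ h > 0, ∃ (w : Euc d) (ρ : ℝ), 0 < ρ ∧ (∀ z ∈ Metric.ball w ρ, ‖z‖ ≤ h) ∧
      ∀ x ∈ Metric.ball x₀ r ∩ Ω, ∀ z ∈ Metric.ball w ρ, ∀ s ∈ Set.Icc (0 : ℝ) 1,
        x + s • z ∈ Ω := by
  have hball : ∀ {r h : ℝ} {x z : Euc d} {s : ℝ}, x ∈ Metric.ball x₀ (r / 2) → ‖z‖ ≤ r / 2 →
      s ∈ Set.Icc (0 : ℝ) 1 → x + s • z ∈ Metric.ball x₀ r := by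
    intro r h x z s hx hz hs
    rw [Metric.mem_ball, dist_eq_norm] at hx ⊢
    have h1 : ‖s • z‖ ≤ r / 2 := by
      rw [norm_smul, Real.norm_of_nonneg hs.1]
      nlinarith [hs.2, norm_nonneg z]
    calc ‖x + s • z - x₀‖ = ‖(x - x₀) + s • z‖ := by congr 1; abel
      _ ≤ ‖x - x₀‖ + ‖s • z‖ := norm_add_le _ _
      _ < r := by linarith
  by_cases hmem : x₀ ∈ Ω
  · obtain ⟨r, hr, hrΩ⟩ := Metric.isOpen_iff.1 hΩ.isOpen x₀ hmem
    refine ⟨r / 2, half_pos hr, fun h hh => ⟨0, min h (r / 2), lt_min hh (half_pos hr), ?_, ?_⟩⟩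
    · intro z hz
      rw [mem_ball_zero_iff] at hz
      exact (hz.trans_le (min_le_left _ _)).le
    · intro x hx z hz s hs
      rw [mem_ball_zero_iff] at hz
      exact hrΩ (hball (h := h) hx.1 (hz.trans_le (min_le_right _ _)).le hs)
  · obtain ⟨r, ν, g, K, hr, hν, hg, hgr⟩ := hΩ.lipschitz x₀
      ⟨hx₀, by rwa [hΩ.isOpen.interior_eq]⟩
    refine ⟨r / 2, half_pos hr, fun h hh => ?_⟩
    -- Vectors in the ball below have norm at most `2 * τ`, which must stay below both `h` and `r /
    -- 2`.
    set τ := min h (r / 2) / 2 with hτ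
    have hτ0 : 0 < τ := half_pos (lt_min hh (half_pos hr))
    have hK : (0 : ℝ) ≤ K := K.2
    -- This solves `2 * K * ρ = τ - ρ`: a step by `z` raises the height by at least `τ - ρ`, while
    -- the graph rises by at most `K * (2 * ρ)`.
    set ρ := τ / (2 * K + 1) with hρ
    have hρ0 : 0 < ρ := by positivity
    have hρτ : 2 * K * ρ = τ - ρ := by
      rw [hρ]; field_simp; ring
    have hnorm : ∀ z ∈ Metric.ball (τ • ν) ρ, ‖z‖ ≤ 2 * τ := by
      intro z hz
      rw [mem_ball_iff_norm] at hz
      have h1 : ‖z‖ ≤ ‖z - τ • ν‖ + ‖τ • ν‖ := by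
        simpa using norm_add_le (z - τ • ν) (τ • ν)
      rw [norm_smul, hν, Real.norm_of_nonneg hτ0.le] at h1
      nlinarith [mul_nonneg hK hρ0.le]
    have hτ2 : 2 * τ = min h (r / 2) := by rw [hτ]; ring
    refine ⟨τ • ν, ρ, hρ0, fun z hz => ?_, fun x hx z hz s hs => ?_⟩
    · exact (hnorm z hz).trans (hτ2.le.trans (min_le_left _ _))
    · have hxz : x + s • z ∈ Metric.ball x₀ r :=
        hball (h := h) hx.1 ((hnorm z hz).trans (hτ2.le.trans (min_le_right _ _))) hs
      rw [hgr _ hxz]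
      have hxr : x ∈ Metric.ball x₀ r := Metric.ball_subset_ball (by linarith) hx.1
      have hgx := (hgr x hxr).1 hx.2
      set y := z - τ • ν with hy
      have hyρ : ‖y‖ < ρ := by rwa [mem_ball_iff_norm] at hz
      have hzy : z = τ • ν + y := by rw [hy]; abel
      have hνν : (inner ℝ ν ν : ℝ) = 1 := by rw [real_inner_self_eq_norm_sq, hν, one_pow]
      have hyν : |(inner ℝ ν y : ℝ)| ≤ ‖y‖ := by
        simpa [hν] using abs_real_inner_le_norm ν y
      have e1 : (inner ℝ ν (x + s • z) : ℝ) = inner ℝ ν x + s * (τ + inner ℝ ν y) := by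
        rw [hzy]
        simp only [inner_add_right, real_inner_smul_right, hνν, mul_one]
      have e2 : x + s • z - (inner ℝ ν (x + s • z) : ℝ) • ν
          = (x - (inner ℝ ν x : ℝ) • ν) + s • (y - (inner ℝ ν y : ℝ) • ν) := by
        rw [e1, hzy]
        module
      have h3 : ‖y - (inner ℝ ν y : ℝ) • ν‖ ≤ 2 * ‖y‖ := by
        refine (norm_sub_le _ _).trans ?_
        rw [norm_smul, hν, mul_one, Real.norm_eq_abs]
        linarith
      have h4 := hg.dist_le_mul (x + s • z - (inner ℝ ν (x + s • z) : ℝ) • ν)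
        (x - (inner ℝ ν x : ℝ) • ν)
      rw [e2, dist_eq_norm, dist_eq_norm, add_sub_cancel_left, norm_smul,
        Real.norm_of_nonneg hs.1, ← e2] at h4
      have h5 := (le_abs_self _).trans h4
      have h6 : (K : ℝ) * (s * ‖y - (inner ℝ ν y : ℝ) • ν‖) ≤ s * (2 * K * ρ) := by
        have : ‖y - (inner ℝ ν y : ℝ) • ν‖ ≤ 2 * ρ := by linarith
        calc (K : ℝ) * (s * ‖y - (inner ℝ ν y : ℝ) • ν‖) ≤ K * (s * (2 * ρ)) := by
              have := hs.1
              gcongr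
          _ = _ := by ring
      rw [hρτ] at h6
      have h7 : s * (τ - ρ) ≤ s * (τ + inner ℝ ν y) := by
        have := hs.1
        gcongr
        linarith [neg_abs_le (inner ℝ ν y : ℝ)]
      exact lt_of_lt_of_eq (by linarith) e1.symm

lemma IsTestFunction.add {η θ : Euc d → ℝ} (h : IsTestFunction V η) (h' : IsTestFunction V θ) :
    IsTestFunction V (η + θ) :=
  ⟨h.smooth.add h'.smooth, h.compact.add h'.compact,
    (tsupport_add η θ).trans (Set.union_subset h.supp h'.supp)⟩

lemma IsTestFunction.const_smul {η : Euc d → ℝ} (h : IsTestFunction V η) (t : ℝ) :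
    IsTestFunction V (t • η) :=
  ⟨h.smooth.const_smul t, h.compact.smul_left (f := fun _ => t),
    (tsupport_smul_subset_right (fun _ => t) η).trans h.supp⟩

lemma isTestFunction_zero : IsTestFunction V (0 : Euc d → ℝ) :=
  ⟨contDiff_const, HasCompactSupport.zero, by simp [tsupport]⟩

/-- The classes of test functions in `L²(V)`. -/
noncomputable def testSubmodule (V : Set (Euc d)) : Submodule ℝ (L2 V) where
  carrier := {g | ∃ η, IsTestFunction V η ∧ g =ᵐ[volume.restrict V] η}
  zero_mem' := ⟨0, isTestFunction_zero, Lp.coeFn_zero ℝ 2 _⟩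
  add_mem' := by
    rintro g g' ⟨η, hη, h⟩ ⟨θ, hθ, h'⟩
    exact ⟨η + θ, hη.add hθ, (Lp.coeFn_add g g').trans (h.add h')⟩
  smul_mem' := by
    rintro t g ⟨η, hη, h⟩
    exact ⟨t • η, hη.const_smul t, (Lp.coeFn_smul t g).trans (h.const_smul t)⟩

/-- Anything orthogonal to all test functions vanishes, by the fundamental lemma of the calculus of
variations. -/
lemma testSubmodule_topologicalClosure (hV : IsOpen V) :
    (testSubmodule V).topologicalClosure = ⊤ := by
  rw [Submodule.topologicalClosure_eq_top_iff, Submodule.eq_bot_iff]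
  intro g hg
  rw [Lp.eq_zero_iff_ae_eq_zero]
  refine (ae_restrict_iff' hV.measurableSet).2
    (hV.ae_eq_zero_of_integral_contDiff_smul_eq_zero (μ := volume)
      (locallyIntegrableOn_of_memLp (Lp.memLp g)) fun η h1 h2 h3 => ?_)
  have hη : IsTestFunction V η := ⟨h1, h2, h3⟩
  have h := (Submodule.mem_orthogonal _ _).1 hg hη.memLp.toLp ⟨η, hη, hη.memLp.coeFn_toLp⟩
  rw [L2.inner_def] at h
  rw [← setIntegral_eq_integral_of_forall_compl_eq_zero (s := V), ← h]
  · refine integral_congr_ae ?_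
    filter_upwards [hη.memLp.coeFn_toLp] with x hx
    rw [hx]
    simp [mul_comm]
  · intro x hx
    rw [image_eq_zero_of_notMem_tsupport fun h => hx (h3 h), zero_smul]

lemma memLp_two_integral_sq {α : Type*} [MeasurableSpace α] {μ : Measure α} {f : α → ℝ}
    (hf : MemLp f 2 μ) : ‖hf.toLp‖ ^ 2 = ∫ x, f x ^ 2 ∂μ := by
  rw [L2_norm_sq_eq]
  refine integral_congr_ae ?_
  filter_upwards [hf.coeFn_toLp] with x hx
  rw [hx, Real.norm_eq_abs, sq_abs]

/-- The `L²` norm by duality with test functions. -/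
lemma integral_sq_le_of_forall_test (hV : IsOpen V) {f : Euc d → ℝ}
    (hf : MemLp f 2 (volume.restrict V)) {M : ℝ} (hM : 0 ≤ M)
    (h : ∀ η, IsTestFunction V η → |∫ x in V, f x * η x| ≤ M * Real.sqrt (∫ x in V, η x ^ 2)) :
    ∫ x in V, f x ^ 2 ≤ M ^ 2 := by
  have key : ∀ g : L2 V, |inner ℝ hf.toLp g| ≤ M * ‖g‖ := by
    have hcl : IsClosed {g : L2 V | |inner ℝ hf.toLp g| ≤ M * ‖g‖} :=
      isClosed_le (continuous_const.inner continuous_id).abs (continuous_const.mul continuous_norm)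
    have hsub : (testSubmodule V : Set (L2 V)) ⊆ {g : L2 V | |inner ℝ hf.toLp g| ≤ M * ‖g‖} := by
      rintro g ⟨η, hη, hg⟩
      have e1 : inner ℝ hf.toLp g = ∫ x in V, f x * η x := by
        rw [L2.inner_def]
        refine integral_congr_ae ?_
        filter_upwards [hf.coeFn_toLp, hg] with x h1 h2
        rw [h1, h2]
        simp [mul_comm]
      have e2 : ‖g‖ = Real.sqrt (∫ x in V, η x ^ 2) := by
        rw [eq_comm, Real.sqrt_eq_iff_eq_sq (integral_nonneg fun x => sq_nonneg _) (norm_nonneg _),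
          L2_norm_sq_eq]
        refine integral_congr_ae ?_
        filter_upwards [hg] with x h2
        rw [h2, Real.norm_eq_abs, sq_abs]
      rw [Set.mem_ofPred_eq, e1, e2]
      exact h η hη
    intro g
    have : g ∈ (testSubmodule V).topologicalClosure := by
      rw [testSubmodule_topologicalClosure hV]; trivial
    exact closure_minimal hsub hcl this
  rw [← memLp_two_integral_sq hf]
  have h1 := (le_abs_self _).trans (key hf.toLp)
  rw [real_inner_self_eq_norm_sq] at h1
  have : ‖hf.toLp‖ ≤ M := by
    rcases (norm_nonneg hf.toLp).eq_or_lt with h0 | h0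
    · rwa [← h0]
    · nlinarith
  gcongr

lemma IsTestFunction.comp_sub {η : Euc d → ℝ} (hη : IsTestFunction V η) {a : Euc d}
    (ha : ∀ x ∈ V, x + a ∈ Ω) : IsTestFunction Ω (fun y => η (y - a)) := by
  refine ⟨hη.smooth.comp (contDiff_id.sub contDiff_const),
    hη.compact.comp_homeomorph (Homeomorph.subRight a), ?_⟩
  intro y hy
  have h1 : y ∈ (Homeomorph.subRight a) ⁻¹' tsupport η := by
    rw [← tsupport_comp_eq_preimage]; exact hy
  have h2 := ha _ (hη.supp h1)
  simpa using h2

lemma abs_integral_inner_mul_le (G : L2Vec Ω) {θ : Euc d → ℝ} (hθ : IsTestFunction Ω θ)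
    (z : Euc d) :
    |∫ x in Ω, (inner ℝ (G x) z : ℝ) * θ x| ≤ ‖z‖ * ‖G‖ * Real.sqrt (∫ x, θ x ^ 2) := by
  have e1 : ∫ x in Ω, (inner ℝ (G x) z : ℝ) * θ x
      = inner ℝ G (MemLp.toLp _ (hθ.memLp_smul_const z)) := by
    rw [L2.inner_def]
    refine integral_congr_ae ?_
    filter_upwards [(hθ.memLp_smul_const z).coeFn_toLp] with x hx
    rw [hx, real_inner_smul_right, mul_comm]
  have e2 : ‖MemLp.toLp _ (hθ.memLp_smul_const z)‖ ≤ ‖z‖ * Real.sqrt (∫ x, θ x ^ 2) := by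
    refine abs_le_of_sq_le_sq' ?_ (by positivity) |>.2
    rw [mul_pow, Real.sq_sqrt (integral_nonneg fun x => sq_nonneg _), L2_norm_sq_eq,
      ← integral_const_mul]
    refine le_of_eq (Eq.trans ?_
      (setIntegral_eq_integral_of_forall_compl_eq_zero (s := Ω) fun x hx => ?_))
    · refine integral_congr_ae ?_
      filter_upwards [(hθ.memLp_smul_const z).coeFn_toLp] with x hx
      rw [hx, norm_smul, mul_pow, Real.norm_eq_abs, sq_abs, mul_comm]
    · rw [image_eq_zero_of_notMem_tsupport fun h => hx (hθ.supp h)]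
      simp
  rw [e1]
  calc _ ≤ ‖G‖ * ‖MemLp.toLp _ (hθ.memLp_smul_const z)‖ := abs_real_inner_le_norm _ _
    _ ≤ ‖G‖ * (‖z‖ * Real.sqrt (∫ x, θ x ^ 2)) := by gcongr
    _ = _ := by ring

lemma integrable_of_L2 [IsFiniteMeasure (volume.restrict Ω)] (u : L2 Ω) :
    Integrable u (volume.restrict Ω) :=
  (Lp.memLp u).integrable (by norm_num)

/-- Translation estimate, tested with a test function. -/
lemma abs_integral_translate_sub_le [IsFiniteMeasure (volume.restrict Ω)] (u : H1 Ω) {z : Euc d}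
    (hV : ∀ x ∈ V, ∀ s ∈ Set.Icc (0 : ℝ) 1, x + s • z ∈ Ω) {η : Euc d → ℝ}
    (hη : IsTestFunction V η) :
    |∫ y in Ω, toL2 u y * (η (y - z) - η y)|
      ≤ ‖z‖ * ‖wgrad u‖ * Real.sqrt (∫ x, η x ^ 2) := by
  have hu := integrable_of_L2 (toL2 u)
  have hdη : Continuous (fderiv ℝ η) := hη.smooth.continuous_fderiv (by simp)
  obtain ⟨K, hK⟩ := (hη.compact.fderiv (𝕜 := ℝ)).exists_bound_of_continuous hdη
  obtain ⟨K', hK'⟩ := hη.compact.exists_bound_of_continuous hη.smooth.continuous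
  have hcont : ∀ s : ℝ, Continuous fun y : Euc d => η (y - s • z) := fun s =>
    hη.smooth.continuous.comp (continuous_id.sub continuous_const)
  have hint : ∀ s : ℝ, Integrable (fun y => toL2 u y * η (y - s • z)) (volume.restrict Ω) :=
    fun s => hu.mul_bdd (c := K') (hcont s).aestronglyMeasurable (ae_of_all _ fun y => hK' _)
  -- The translation sits on the smooth `η`, so the integral can be differentiated in `s` although
  -- `u` is only Sobolev.
  have hderiv : ∀ s : ℝ, HasDerivAt (fun s : ℝ => ∫ y in Ω, toL2 u y * η (y - s • z))
      (∫ y in Ω, toL2 u y * fderiv ℝ η (y - s • z) (-z)) s := by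
    intro s
    refine (hasDerivAt_integral_of_dominated_loc_of_deriv_le (s := Set.univ)
      (F := fun s y => toL2 u y * η (y - s • z))
      (F' := fun s y => toL2 u y * fderiv ℝ η (y - s • z) (-z))
      (bound := fun y => ‖toL2 u y‖ * (K * ‖-z‖)) univ_mem
      (Eventually.of_forall fun s => (hint s).aestronglyMeasurable) (hint s) ?_ ?_ ?_ ?_).2
    · exact hu.aestronglyMeasurable.mul ((hdη.comp (continuous_id.sub continuous_const)).clm_apply
        continuous_const).aestronglyMeasurable
    · refine ae_of_all _ fun y s _ => ?_
      rw [norm_mul]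
      gcongr
      exact (ContinuousLinearMap.le_opNorm _ _).trans (by gcongr; exact hK _)
    · exact hu.norm.mul_const _
    · refine ae_of_all _ fun y s _ => ?_
      refine HasDerivAt.const_mul _ ?_
      have h1 : HasDerivAt (fun s : ℝ => y - s • z) (-z) s := by
        simpa using ((hasDerivAt_id s).smul_const z).const_sub y
      exact ((hη.smooth.differentiable (by simp) _).hasFDerivAt).comp_hasDerivAt s h1
  have hbound : ∀ s ∈ Set.Ico (0 : ℝ) 1,
      ‖∫ y in Ω, toL2 u y * fderiv ℝ η (y - s • z) (-z)‖
        ≤ ‖z‖ * ‖wgrad u‖ * Real.sqrt (∫ x, η x ^ 2) := by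
    intro s hs
    -- The hypothesis on segments keeps the shifted support in `Ω` for every `s`, so the derivative
    -- can be moved onto `u`.
    have ht : IsTestFunction Ω fun y => η (y - s • z) :=
      hη.comp_sub fun x hx => hV x hx s ⟨hs.1, hs.2.le⟩
    have h1 := isWeakGradient_wgrad u _ ht (-z)
    simp only [fderiv_comp_sub] at h1
    rw [h1, norm_neg, Real.norm_eq_abs]
    have h2 := abs_integral_inner_mul_le (wgrad u) ht (-z)
    rwa [norm_neg, integral_sub_right_eq_self (fun x => η x ^ 2)] at h2
  have h := norm_image_sub_le_of_norm_deriv_le_segment_01'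
    (fun s _ => (hderiv s).hasDerivWithinAt) hbound
  rw [← integral_sub (hint 1) (hint 0), Real.norm_eq_abs] at h
  simpa only [one_smul, zero_smul, sub_zero, ← mul_sub] using h

end Translation

/-! ### Averages over small shifted balls -/

section Averages

variable {d : ℕ} {Ω V : Set (Euc d)}

/-- Extension by zero. -/
noncomputable def extZero (u : L2 Ω) : Euc d → ℝ := Ω.indicator u

lemma stronglyMeasurable_extZero (hΩ : MeasurableSet Ω) (u : L2 Ω) :
    StronglyMeasurable (extZero u) :=
  (Lp.stronglyMeasurable u).indicator hΩ

lemma integrable_extZero [IsFiniteMeasure (volume.restrict Ω)] (hΩ : MeasurableSet Ω) (u : L2 Ω) :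
    Integrable (extZero u) :=
  (integrable_indicator_iff hΩ).2 (integrable_of_L2 u)

lemma memLp_extZero (hΩ : MeasurableSet Ω) (u : L2 Ω) : MemLp (extZero u) 2 volume :=
  (memLp_indicator_iff_restrict hΩ).2 (Lp.memLp u)

lemma integral_extZero_mul (hΩ : MeasurableSet Ω) (u : L2 Ω) (g : Euc d → ℝ) :
    ∫ x, extZero u x * g x = ∫ x in Ω, u x * g x := by
  rw [← setIntegral_eq_integral_of_forall_compl_eq_zero (s := Ω)]
  · refine setIntegral_congr_fun hΩ fun x hx => ?_
    simp [extZero, hx]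
  · intro x hx
    simp [extZero, hx]

/-- The integral of `u` over `x + B_ρ(w)`. -/
noncomputable def ballIntegral (w : Euc d) (ρ : ℝ) (u : L2 Ω) (x : Euc d) : ℝ :=
  ∫ z in Metric.ball w ρ, extZero u (x + z)

lemma stronglyMeasurable_ballIntegral (hΩ : MeasurableSet Ω) (w : Euc d) (ρ : ℝ) (u : L2 Ω) :
    StronglyMeasurable (ballIntegral w ρ u) := by
  refine StronglyMeasurable.integral_prod_right (f := fun x z => extZero u (x + z)) ?_
  exact (stronglyMeasurable_extZero hΩ u).comp_measurable (measurable_fst.add measurable_snd)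

variable [IsFiniteMeasure (volume.restrict Ω)]

lemma abs_ballIntegral_le (hΩ : MeasurableSet Ω) (w : Euc d) (ρ : ℝ) (u : L2 Ω) (x : Euc d) :
    |ballIntegral w ρ u x| ≤ ∫ y, |extZero u y| := by
  have hE := (integrable_extZero hΩ u).comp_add_left x
  calc |ballIntegral w ρ u x| ≤ ∫ z in Metric.ball w ρ, |extZero u (x + z)| :=
        abs_integral_le_integral_abs
    _ ≤ ∫ z, |extZero u (x + z)| :=
        setIntegral_le_integral hE.abs (ae_of_all _ fun z => abs_nonneg _)
    _ = _ := integral_add_left_eq_self (fun y => |extZero u y|) x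

/-- The difference between a Sobolev function and its averages over small translated balls. -/
lemma integral_sub_ballIntegral_sq_le (hΩ : IsOpen Ω) (hVo : IsOpen V) (hVΩ : V ⊆ Ω) (u : H1 Ω)
    {w : Euc d} {ρ h : ℝ} (hh : ∀ z ∈ Metric.ball w ρ, ‖z‖ ≤ h) (hh0 : 0 ≤ h)
    (hV : ∀ x ∈ V, ∀ z ∈ Metric.ball w ρ, ∀ s ∈ Set.Icc (0 : ℝ) 1, x + s • z ∈ Ω) :
    ∫ x in V, (volume.real (Metric.ball w ρ) * extZero (toL2 u) x
      - ballIntegral w ρ (toL2 u) x) ^ 2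
      ≤ (volume.real (Metric.ball w ρ) * h * ‖wgrad u‖) ^ 2 := by
  have hΩm := hΩ.measurableSet
  set κ := volume.real (Metric.ball w ρ) with hκ
  have hκ0 : 0 ≤ κ := measureReal_nonneg
  set e := extZero (toL2 u) with he
  have hE : Integrable e := integrable_extZero hΩm _
  have hfinV : IsFiniteMeasure (volume.restrict V) :=
    isFiniteMeasure_of_le (volume.restrict Ω) (Measure.restrict_mono hVΩ le_rfl)
  have hA : MemLp (ballIntegral w ρ (toL2 u)) 2 (volume.restrict V) :=
    MemLp.of_bound (stronglyMeasurable_ballIntegral hΩm w ρ _).aestronglyMeasurable _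
      (ae_of_all _ fun x => abs_ballIntegral_le hΩm w ρ _ x)
  refine integral_sq_le_of_forall_test hVo
    ((((memLp_extZero hΩm (toL2 u)).restrict V).const_mul κ).sub hA) (by positivity) ?_
  intro η hη
  obtain ⟨K', hK'⟩ := hη.compact.exists_bound_of_continuous hη.smooth.continuous
  have hη0 : ∀ x ∉ V, η x = 0 := fun x hx =>
    image_eq_zero_of_notMem_tsupport fun h => hx (hη.supp h)
  have hfinQ : IsFiniteMeasure (volume.restrict (Metric.ball w ρ)) :=
    isFiniteMeasure_restrict.2 Metric.isBounded_ball.measure_lt_top.ne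
  have hP : Integrable (fun p : Euc d × Euc d => e (p.1 + p.2))
      (volume.prod (volume.restrict (Metric.ball w ρ))) := by
    refine (integrable_prod_iff' ?_).2 ⟨ae_of_all _ fun z => hE.comp_add_right z, ?_⟩
    · exact ((stronglyMeasurable_extZero hΩm _).comp_measurable
        (measurable_fst.add measurable_snd)).aestronglyMeasurable
    · simp only [integral_add_right_eq_self (fun x => ‖e x‖)]
      exact integrable_const _
  have hI : Integrable (Function.uncurry fun x z : Euc d => (e x - e (x + z)) * η x)
      (volume.prod (volume.restrict (Metric.ball w ρ))) := by
    refine ((hE.comp_fst _).sub hP).mul_bdd (c := K') ?_ (ae_of_all _ fun p => hK' _)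
    exact (hη.smooth.continuous.comp continuous_fst).aestronglyMeasurable
  -- Tested with `η`, the difference becomes a double integral; after Fubini the translation
  -- estimate applies for each `z` separately.
  have e1 : ∫ x in V, (κ * e x - ballIntegral w ρ (toL2 u) x) * η x
      = ∫ x, ∫ z in Metric.ball w ρ, (e x - e (x + z)) * η x := by
    rw [setIntegral_eq_integral_of_forall_compl_eq_zero]
    · refine integral_congr_ae (ae_of_all _ fun x => ?_)
      simp only
      rw [integral_mul_const, integral_sub (integrable_const _)
        (hE.comp_add_left x).integrableOn, setIntegral_const, smul_eq_mul]
      rfl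
    · intro x hx
      rw [hη0 x hx, mul_zero]
  have e2 : ∀ z ∈ Metric.ball w ρ, ‖∫ x, (e x - e (x + z)) * η x‖
      ≤ h * ‖wgrad u‖ * Real.sqrt (∫ x, η x ^ 2) := by
    intro z hz
    have i1 : Integrable (fun x => e x * η x) :=
      hE.mul_bdd hη.smooth.continuous.aestronglyMeasurable (ae_of_all _ hK')
    have i2 : Integrable (fun x => e (x + z) * η x) :=
      (hE.comp_add_right z).mul_bdd hη.smooth.continuous.aestronglyMeasurable (ae_of_all _ hK')
    have i3 : Integrable (fun x => e x * η (x - z)) := by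
      simpa using i2.comp_sub_right z
    have h1 : ∫ x, e (x + z) * η x = ∫ x, e x * η (x - z) := by
      rw [← integral_sub_right_eq_self (fun x => e (x + z) * η x) z]
      simp
    have h2 : ∫ x, (e x - e (x + z)) * η x
        = - ∫ y in Ω, toL2 u y * (η (y - z) - η y) := by
      rw [← integral_extZero_mul hΩm]
      simp only [sub_mul, mul_sub]
      rw [integral_sub i1 i2, integral_sub i3 i1, h1]
      ring
    rw [h2, norm_neg, Real.norm_eq_abs]
    refine (abs_integral_translate_sub_le u (fun x hx s hs => hV x hx z hz s hs) hη).trans ?_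
    gcongr
    exact hh z hz
  change |∫ x in V, (κ * e x - ballIntegral w ρ (toL2 u) x) * η x| ≤ _
  rw [e1, integral_integral_swap hI]
  have h3 := norm_setIntegral_le_of_norm_le_const (μ := volume)
    (Metric.isBounded_ball (x := w) (r := ρ)).measure_lt_top e2
  rw [Real.norm_eq_abs] at h3
  rw [setIntegral_eq_integral_of_forall_compl_eq_zero (s := V) fun x hx => by simp [hη0 x hx]]
  refine h3.trans (le_of_eq ?_)
  ring

/-- As an inner product with a fixed `L²` function, the average at each point is a continuous
functional of `u`, hence sees weak convergence. -/
lemma ballIntegral_eq_inner (hΩ : MeasurableSet Ω) (w : Euc d) (ρ : ℝ) (u : L2 Ω) (x : Euc d) :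
    ballIntegral w ρ u x = inner ℝ (indicatorConstLp (μ := volume.restrict Ω) 2
      (Metric.isOpen_ball (x := x + w) (ε := ρ)).measurableSet (measure_ne_top _ _) (1 : ℝ)) u := by
  rw [L2.inner_indicatorConstLp_one, Measure.restrict_restrict Metric.isOpen_ball.measurableSet,
    ← setIntegral_indicator hΩ]
  have := (measurePreserving_add_left volume x).setIntegral_preimage_emb
    (measurableEmbedding_addLeft x) (extZero u) (Metric.ball (x + w) ρ)
  have hpre : (fun z => x + z) ⁻¹' Metric.ball (x + w) ρ = Metric.ball w ρ := by
    ext z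
    simp
  rw [hpre] at this
  exact this

lemma abs_ballIntegral_le_norm (hΩ : MeasurableSet Ω) (w : Euc d) (ρ : ℝ) (u : L2 Ω) (x : Euc d) :
    |ballIntegral w ρ u x| ≤ volume.real Ω ^ (1 / 2 : ℝ) * ‖u‖ := by
  rw [ballIntegral_eq_inner hΩ]
  refine (abs_real_inner_le_norm _ _).trans ?_
  gcongr
  refine norm_indicatorConstLp_le.trans ?_
  rw [norm_one, one_mul, ENNReal.toReal_ofNat]
  refine Real.rpow_le_rpow measureReal_nonneg ?_ (by norm_num)
  calc _ ≤ (volume.restrict Ω).real Set.univ := measureReal_mono (Set.subset_univ _)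
    _ = volume.real Ω := by rw [measureReal_restrict_apply_univ]

/-- Weak convergence gives convergence at every point, and the bound uniform in `x` and `n` allows
dominated convergence on a set of finite measure. -/
lemma tendsto_setIntegral_ballIntegral_sq (hΩ : MeasurableSet Ω) (hVΩ : V ⊆ Ω) (w : Euc d) (ρ : ℝ)
    {u : ℕ → H1 Ω} {R : ℝ} (hR : ∀ n, ‖u n‖ ≤ R) (hu : WeakTendsto u 0) :
    Tendsto (fun n => ∫ x in V, ballIntegral w ρ (toL2 (u n)) x ^ 2) atTop (𝓝 0) := by
  have hfinV : IsFiniteMeasure (volume.restrict V) :=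
    isFiniteMeasure_of_le (volume.restrict Ω) (Measure.restrict_mono hVΩ le_rfl)
  have h0 : (0 : ℝ) = ∫ x in V, (0 : ℝ) := by simp
  rw [h0]
  refine tendsto_integral_of_dominated_convergence
    (fun _ => (volume.real Ω ^ (1 / 2 : ℝ) * R) ^ 2)
    (fun n => ((stronglyMeasurable_ballIntegral hΩ w ρ _).pow 2).aestronglyMeasurable)
    (integrable_const _) (fun n => ae_of_all _ fun x => ?_) (ae_of_all _ fun x => ?_)
  · rw [norm_pow, Real.norm_eq_abs]
    have h1 : ‖toL2 (u n)‖ ≤ R := by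
      refine (abs_le_of_sq_le_sq' ?_ (norm_nonneg (u n))).2.trans (hR n)
      rw [H1_norm_sq]
      nlinarith [sq_nonneg ‖wgrad (u n)‖]
    have h2 := abs_ballIntegral_le_norm hΩ w ρ (toL2 (u n)) x
    gcongr
    exact h2.trans (by gcongr)
  · simp only [ballIntegral_eq_inner hΩ]
    have h1 := hu ((innerSL ℝ (indicatorConstLp (μ := volume.restrict Ω) 2
      (Metric.isOpen_ball (x := x + w) (ε := ρ)).measurableSet (measure_ne_top _ _) (1 : ℝ))).comp
      (toL2L Ω))
    rw [map_zero] at h1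
    simpa using h1.pow 2

end Averages

/-! ### Compactness of the embedding into `L²` -/

section Rellich

variable {d : ℕ} {Ω : Set (Euc d)}

lemma IsBoundedLipschitzDomain.isFiniteMeasure (hΩ : IsBoundedLipschitzDomain Ω) :
    IsFiniteMeasure (volume.restrict Ω) :=
  isFiniteMeasure_restrict.2 hΩ.isBounded.measure_lt_top.ne

lemma norm_wgrad_le (u : H1 Ω) : ‖wgrad u‖ ≤ ‖u‖ := by
  refine (abs_le_of_sq_le_sq' ?_ (norm_nonneg u)).2
  rw [H1_norm_sq]
  nlinarith [sq_nonneg ‖toL2 u‖]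

lemma L2_integrable_sq (u : L2 Ω) : IntegrableOn (fun x => u x ^ 2) Ω := by
  simpa [IntegrableOn] using L2_integrable_norm_sq u

/-- The function is split into its average and the deviation from it. The deviation is small
uniformly in `n` once `h` is small; with `w` and `ρ` then fixed, the averages vanish as `n → ∞`. -/
lemma tendsto_setIntegral_sq_of_cone (hΩ : IsBoundedLipschitzDomain Ω) {x₀ : Euc d}
    (hx₀ : x₀ ∈ closure Ω) :
    ∃ r > 0, ∀ (u : ℕ → H1 Ω) (R : ℝ), (∀ n, ‖u n‖ ≤ R) → WeakTendsto u 0 →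
      Tendsto (fun n => ∫ x in Metric.ball x₀ r ∩ Ω, toL2 (u n) x ^ 2) atTop (𝓝 0) := by
  have := hΩ.isFiniteMeasure
  obtain ⟨r, hr, hcone⟩ := hΩ.exists_cone hx₀
  refine ⟨r, hr, fun u R hR hu => ?_⟩
  set V := Metric.ball x₀ r ∩ Ω with hV
  have hVΩ : V ⊆ Ω := Set.inter_subset_right
  have hVo : IsOpen V := Metric.isOpen_ball.inter hΩ.isOpen
  have hΩm := hΩ.isOpen.measurableSet
  have hfinV : IsFiniteMeasure (volume.restrict V) :=
    isFiniteMeasure_of_le (volume.restrict Ω) (Measure.restrict_mono hVΩ le_rfl)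
  have hR0 : 0 ≤ R := (norm_nonneg _).trans (hR 0)
  rw [tendsto_order]
  refine ⟨fun a ha => Eventually.of_forall fun n =>
    ha.trans_le (integral_nonneg fun x => sq_nonneg _), fun ε hε => ?_⟩
  obtain ⟨h, hh, hhε⟩ : ∃ h > 0, 2 * (h * R) ^ 2 < ε / 2 := by
    have h1 : Tendsto (fun h : ℝ => 2 * (h * R) ^ 2) (𝓝[>] 0) (𝓝 0) := by
      have : Continuous fun h : ℝ => 2 * (h * R) ^ 2 := by fun_prop
      simpa using (this.tendsto 0).mono_left nhdsWithin_le_nhds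
    obtain ⟨h, h2, h3⟩ := ((h1.eventually_lt_const (half_pos hε)).and
      self_mem_nhdsWithin).exists
    exact ⟨h, h3, h2⟩
  obtain ⟨w, ρ, hρ, hwh, hcone⟩ := hcone h hh
  set κ := volume.real (Metric.ball w ρ) with hκ
  have hκ0 : 0 < κ := ENNReal.toReal_pos (Metric.measure_ball_pos volume w hρ).ne'
    Metric.isBounded_ball.measure_lt_top.ne
  have hA := (tendsto_setIntegral_ballIntegral_sq hΩm hVΩ w ρ hR hu).const_mul (2 / κ ^ 2)
  rw [mul_zero] at hA
  filter_upwards [hA.eventually_lt_const (half_pos hε)] with n hn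
  have hest := integral_sub_ballIntegral_sq_le hΩ.isOpen hVo hVΩ (u n) hwh hh.le hcone
  have hAmem : MemLp (ballIntegral w ρ (toL2 (u n))) 2 (volume.restrict V) :=
    MemLp.of_bound (stronglyMeasurable_ballIntegral hΩm w ρ _).aestronglyMeasurable _
      (ae_of_all _ fun x => abs_ballIntegral_le hΩm w ρ _ x)
  have hDmem : MemLp (fun x => κ * extZero (toL2 (u n)) x - ballIntegral w ρ (toL2 (u n)) x) 2
      (volume.restrict V) := (((memLp_extZero hΩm (toL2 (u n))).restrict V).const_mul κ).sub hAmem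
  have hpt : ∫ x in V, κ ^ 2 * toL2 (u n) x ^ 2 ≤ ∫ x in V,
      (2 * (κ * extZero (toL2 (u n)) x - ballIntegral w ρ (toL2 (u n)) x) ^ 2
        + 2 * ballIntegral w ρ (toL2 (u n)) x ^ 2) := by
    refine setIntegral_mono_on (((L2_integrable_sq _).mono_set hVΩ).const_mul _)
      ((hDmem.integrable_sq.const_mul 2).add (hAmem.integrable_sq.const_mul 2))
      hVo.measurableSet fun x hx => ?_
    have : extZero (toL2 (u n)) x = toL2 (u n) x := by simp [extZero, hVΩ hx]
    rw [this]
    -- The identity `2 * (p - q) ^ 2 + 2 * q ^ 2 - p ^ 2 = (p - 2 * q) ^ 2`.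
    nlinarith [sq_nonneg (κ * toL2 (u n) x - 2 * ballIntegral w ρ (toL2 (u n)) x)]
  rw [integral_const_mul, integral_add (hDmem.integrable_sq.const_mul 2)
    (hAmem.integrable_sq.const_mul 2), integral_const_mul, integral_const_mul] at hpt
  have hest' : (κ * h * ‖wgrad (u n)‖) ^ 2 ≤ κ ^ 2 * (h * R) ^ 2 := by
    rw [mul_assoc, mul_pow]
    gcongr
    exact (norm_wgrad_le _).trans (hR n)
  have hdiv : ∫ x in V, toL2 (u n) x ^ 2 ≤ 2 * (h * R) ^ 2
      + 2 / κ ^ 2 * ∫ x in V, ballIntegral w ρ (toL2 (u n)) x ^ 2 := by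
    rw [← mul_le_mul_iff_right₀ (pow_pos hκ0 2)]
    refine hpt.trans ?_
    have e : κ ^ 2 * (2 * (h * R) ^ 2 + 2 / κ ^ 2 * ∫ x in V, ballIntegral w ρ (toL2 (u n)) x ^ 2)
        = 2 * (κ ^ 2 * (h * R) ^ 2) + 2 * ∫ x in V, ballIntegral w ρ (toL2 (u n)) x ^ 2 := by
      field_simp
    rw [e]
    linarith [hest.trans hest']
  linarith

/-- The **Rellich–Kondrachov theorem** for `H¹(Ω) → L²(Ω)` on bounded Lipschitz domains. -/
theorem isCompletelyContinuous_toL2 (hΩ : IsBoundedLipschitzDomain Ω) :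
    IsCompletelyContinuous (toL2L Ω) := by
  intro u u₀ R hR hu
  rw [tendsto_iff_norm_sub_tendsto_zero]
  simp only [← map_sub]
  simp only [toL2L_apply]
  have hR' : ∀ n, ‖u n - u₀‖ ≤ R + ‖u₀‖ := fun n =>
    (norm_sub_le _ _).trans (by gcongr; exact hR n)
  have hu' : WeakTendsto (fun n => u n - u₀) 0 := fun f => by
    simpa using (hu f).sub_const (f u₀)
  have hK : IsCompact (closure Ω) := hΩ.isBounded.isCompact_closure
  have key : Tendsto (fun n => ∫ x in closure Ω ∩ Ω, toL2 (u n - u₀) x ^ 2) atTop (𝓝 0) := by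
    have hint : ∀ n (S : Set (Euc d)), IntegrableOn (fun x => toL2 (u n - u₀) x ^ 2) (S ∩ Ω) :=
      fun n S => (L2_integrable_sq _).mono_set Set.inter_subset_right
    -- Vanishing of the mass on `S ∩ Ω` passes to subsets and finite unions, so the local statement
    -- at points of the compact closure suffices.
    refine hK.induction_on
      (p := fun S => Tendsto (fun n => ∫ x in S ∩ Ω, toL2 (u n - u₀) x ^ 2) atTop (𝓝 0))
      (by simp) ?_ ?_ ?_
    · intro S T hST hT
      refine squeeze_zero (fun n => integral_nonneg fun x => sq_nonneg _) (fun n => ?_) hT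
      exact setIntegral_mono_set (hint n T) (ae_of_all _ fun x => sq_nonneg _)
        (LE.le.eventuallyLE (Set.inter_subset_inter_left _ hST))
    · intro S T hS hT
      refine squeeze_zero (fun n => integral_nonneg fun x => sq_nonneg _) (fun n => ?_)
        (by simpa using hS.add hT)
      rw [Set.union_inter_distrib_right, ← integral_add_measure (hint n S) (hint n T)]
      exact integral_mono_measure (Measure.restrict_union_le _ _)
        (ae_of_all _ fun x => sq_nonneg _) (Integrable.add_measure (hint n S) (hint n T))
    · intro x hx
      obtain ⟨r, hr, h⟩ := tendsto_setIntegral_sq_of_cone hΩ hx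
      exact ⟨Metric.ball x r, mem_nhdsWithin_of_mem_nhds (Metric.ball_mem_nhds x hr),
        h _ _ hR' hu'⟩
  rw [Set.inter_eq_right.2 subset_closure] at key
  have h2 : ∀ n, ‖toL2 (u n - u₀)‖ = Real.sqrt (∫ x in Ω, toL2 (u n - u₀) x ^ 2) := fun n => by
    rw [eq_comm, Real.sqrt_eq_iff_eq_sq (integral_nonneg fun x => sq_nonneg _) (norm_nonneg _),
      L2_norm_sq_eq]
    simp
  simp only [h2]
  simpa using key.sqrt

end Rellich

/-! ### Zero gradients, constants and independent test functions -/

section ZeroGradient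

variable {d : ℕ} {Ω : Set (Euc d)}

lemma ballIntegral_add (w : Euc d) (ρ : ℝ) (u : L2 Ω) (x : Euc d) :
    ballIntegral 0 ρ u (x + w) = ballIntegral w ρ u x := by
  have := (measurePreserving_add_left volume w).setIntegral_preimage_emb
    (measurableEmbedding_addLeft w) (fun z => extZero u (x + z)) (Metric.ball w ρ)
  have hpre : (fun z => w + z) ⁻¹' Metric.ball w ρ = Metric.ball 0 ρ := by
    ext z
    simp
  rw [hpre] at this
  rw [ballIntegral, ballIntegral, ← this]
  simp only [add_assoc]

/-- A Sobolev function with vanishing gradient is locally constant. -/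
lemma exists_ae_eq_const_ball [IsFiniteMeasure (volume.restrict Ω)] (hΩ : IsOpen Ω) {u : H1 Ω}
    (hu : wgrad u = 0) {x₀ : Euc d} (hx₀ : x₀ ∈ Ω) :
    ∃ δ > 0, Metric.ball x₀ δ ⊆ Ω ∧
      ∃ c : ℝ, ∀ᵐ x ∂volume.restrict (Metric.ball x₀ δ), toL2 u x = c := by
  obtain ⟨r, hr, hrΩ⟩ := Metric.isOpen_iff.1 hΩ x₀ hx₀
  have hΩm := hΩ.measurableSet
  -- Points of `V` are within `δ` of `x₀` and are shifted by at most `3 * δ`, so they stay in the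
  -- ball of radius `r`.
  set δ := r / 4 with hδ
  have hδ0 : 0 < δ := by positivity
  set V := Metric.ball x₀ δ with hV
  have hVΩ : V ⊆ Ω := (Metric.ball_subset_ball (by linarith)).trans hrΩ
  have hVo : IsOpen V := Metric.isOpen_ball
  have hfinV : IsFiniteMeasure (volume.restrict V) :=
    isFiniteMeasure_of_le (volume.restrict Ω) (Measure.restrict_mono hVΩ le_rfl)
  set W : Set (Euc d) := Metric.ball 0 (2 * δ) with hW
  set κ : Euc d → ℝ := fun w => volume.real (Metric.ball w δ) with hκ
  have hκw : ∀ w, κ w = κ 0 := fun w => by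
    simp only [hκ, Measure.real, Measure.addHaar_ball_center volume w]
  have hκ0 : 0 < κ 0 := ENNReal.toReal_pos (Metric.measure_ball_pos volume 0 hδ0).ne'
    Metric.isBounded_ball.measure_lt_top.ne
  set g := ballIntegral 0 δ (toL2 u) with hg
  have hgm : StronglyMeasurable g := stronglyMeasurable_ballIntegral hΩm _ _ _
  -- With zero gradient the deviation estimate has right side `0`: the function agrees with its
  -- average around every shifted centre.
  have heq : ∀ w ∈ W, ∀ᵐ x ∂volume.restrict V, κ 0 * extZero (toL2 u) x = g (x + w) := by
    intro w hw
    rw [hW, mem_ball_zero_iff] at hw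
    have hz3 : ∀ z ∈ Metric.ball w δ, ‖z‖ ≤ 3 * δ := by
      intro z hz
      rw [mem_ball_iff_norm] at hz
      have : ‖z‖ ≤ ‖z - w‖ + ‖w‖ := by simpa using norm_add_le (z - w) w
      linarith
    have h1 := integral_sub_ballIntegral_sq_le hΩ hVo hVΩ u hz3 (by positivity) (by
      intro x hx z hz s hs
      refine hrΩ ?_
      have h2 := hz3 z hz
      rw [hV, mem_ball_iff_norm] at hx
      rw [mem_ball_iff_norm]
      have h3 : ‖s • z‖ ≤ ‖z‖ := by
        rw [norm_smul, Real.norm_of_nonneg hs.1]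
        exact mul_le_of_le_one_left (norm_nonneg _) hs.2
      calc ‖x + s • z - x₀‖ = ‖(x - x₀) + s • z‖ := by congr 1; abel
        _ ≤ ‖x - x₀‖ + ‖s • z‖ := norm_add_le _ _
        _ < r := by linarith)
    rw [hu, norm_zero, mul_zero, zero_pow two_ne_zero] at h1
    have hA : MemLp (ballIntegral w δ (toL2 u)) 2 (volume.restrict V) :=
      MemLp.of_bound (stronglyMeasurable_ballIntegral hΩm w δ _).aestronglyMeasurable _
        (ae_of_all _ fun x => abs_ballIntegral_le hΩm w δ _ x)
    have hD : MemLp (fun x => κ w * extZero (toL2 u) x - ballIntegral w δ (toL2 u) x) 2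
      (volume.restrict V) := (((memLp_extZero hΩm (toL2 u)).restrict V).const_mul (κ w)).sub hA
    have h2 := (integral_eq_zero_iff_of_nonneg (fun x => sq_nonneg _) hD.integrable_sq).1
      (le_antisymm h1 (integral_nonneg fun x => sq_nonneg _))
    filter_upwards [h2] with x hx
    rw [hg, ballIntegral_add, ← hκw w]
    have h3 : (κ w * extZero (toL2 u) x - ballIntegral w δ (toL2 u) x) ^ 2 = 0 := hx
    exact sub_eq_zero.1 (pow_eq_zero_iff two_ne_zero |>.1 h3)
  have hem := stronglyMeasurable_extZero hΩm (toL2 u)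
  have hmeas : MeasurableSet {p : Euc d × Euc d | κ 0 * extZero (toL2 u) p.1 = g (p.1 + p.2)} :=
    measurableSet_eq_fun ((hem.measurable.comp measurable_fst).const_mul _)
      (hgm.measurable.comp (measurable_fst.add measurable_snd))
  -- Exchanging the quantifiers yields one point `x'` good for almost every shift; the points `x' +
  -- w` with `‖w‖ < 2 * δ` cover `V`, so `g` is constant there.
  have hswap : ∀ᵐ x ∂volume.restrict V, ∀ᵐ w ∂volume.restrict W,
      κ 0 * extZero (toL2 u) x = g (x + w) := by
    refine (Measure.ae_ae_comm (p := fun x w => κ 0 * extZero (toL2 u) x = g (x + w))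
      hmeas).2 ?_
    exact (ae_restrict_iff' Metric.isOpen_ball.measurableSet).2 (ae_of_all _ heq)
  have hVne : (ae (volume.restrict V)).NeBot := by
    rw [ae_restrict_neBot]
    exact (Metric.measure_ball_pos volume x₀ hδ0).ne'
  obtain ⟨x', hx', hx'V⟩ := (hswap.and (ae_restrict_mem hVo.measurableSet)).exists
  refine ⟨δ, hδ0, hVΩ, (κ 0)⁻¹ * (κ 0 * extZero (toL2 u) x'), ?_⟩
  have hconst : ∀ᵐ y ∂volume.restrict V, κ 0 * extZero (toL2 u) x' = g y := by
    rw [ae_restrict_iff' hVo.measurableSet]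
    rw [ae_restrict_iff' Metric.isOpen_ball.measurableSet] at hx'
    have h1 := (measurePreserving_add_left volume (-x')).quasiMeasurePreserving.ae hx'
    filter_upwards [h1] with y hy hyV
    have h2 := hy (by
      rw [mem_ball_zero_iff]
      rw [hV, mem_ball_iff_norm] at hyV hx'V
      calc ‖-x' + y‖ = ‖(y - x₀) - (x' - x₀)‖ := by congr 1; abel
        _ ≤ ‖y - x₀‖ + ‖x' - x₀‖ := norm_sub_le _ _
        _ < 2 * δ := by linarith)
    simpa using h2
  filter_upwards [hconst, heq 0 (Metric.mem_ball_self (by positivity)),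
    ae_restrict_mem hVo.measurableSet] with y h1 h2 h3
  rw [h1, ← add_zero y, ← h2, add_zero, inv_mul_cancel_left₀ hκ0.ne']
  simp [extZero, hVΩ h3]

/-- On a bounded domain, a Sobolev function with vanishing gradient is constant. -/
theorem exists_ae_eq_const_of_wgrad_eq_zero [IsFiniteMeasure (volume.restrict Ω)] (hΩ : IsOpen Ω)
    (hconn : IsConnected Ω) {u : H1 Ω} (hu : wgrad u = 0) :
    ∃ c : ℝ, toL2 u =ᵐ[volume.restrict Ω] fun _ => c := by
  have hloc := fun x (hx : x ∈ Ω) => exists_ae_eq_const_ball hΩ hu hx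
  choose! δ hδ hδΩ c hc using hloc
  obtain ⟨x₁, hx₁⟩ := hconn.nonempty
  have hcc : ∀ y ∈ Ω, c x₁ = c y := by
    intro y hy
    -- Nearby points have balls that meet in a set of positive measure, so their constants agree;
    -- connectedness spreads this over `Ω`.
    refine hconn.isPreconnected.induction₂ (fun x y => c x = c y) ?_
      (fun x y z _ _ _ h h' => h.trans h') (fun x y _ _ h => h.symm) hx₁ hy
    intro x hx
    filter_upwards [mem_nhdsWithin_of_mem_nhds (Metric.ball_mem_nhds x (hδ x hx)),
      self_mem_nhdsWithin] with y hyx hyΩ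
    set T := Metric.ball x (δ x) ∩ Metric.ball y (δ y)
    have hTne : (ae (volume.restrict T)).NeBot := by
      rw [ae_restrict_neBot]
      exact ((Metric.isOpen_ball.inter Metric.isOpen_ball).measure_pos volume
        ⟨y, hyx, Metric.mem_ball_self (hδ y hyΩ)⟩).ne'
    have h1 : ∀ᵐ z ∂volume.restrict T, toL2 u z = c x :=
      ae_restrict_of_ae_restrict_of_subset Set.inter_subset_left (hc x hx)
    have h2 : ∀ᵐ z ∂volume.restrict T, toL2 u z = c y :=
      ae_restrict_of_ae_restrict_of_subset Set.inter_subset_right (hc y hyΩ)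
    obtain ⟨z, hz1, hz2⟩ := (h1.and h2).exists
    exact hz1.symm.trans hz2
  refine ⟨c x₁, (ae_restrict_iff' hΩ.measurableSet).2 ?_⟩
  rw [ae_iff]
  refine measure_null_of_locally_null _ fun x hx => ?_
  have hxΩ : x ∈ Ω := by
    by_contra h
    exact hx fun h' => absurd h' h
  refine ⟨Metric.ball x (δ x) ∩ {z | ¬ (z ∈ Ω → toL2 u z = c x₁)},
    Filter.inter_mem (mem_nhdsWithin_of_mem_nhds (Metric.ball_mem_nhds x (hδ x hxΩ)))
      self_mem_nhdsWithin, ?_⟩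
  have h1 := hc x hxΩ
  rw [ae_restrict_iff' Metric.isOpen_ball.measurableSet, ae_iff] at h1
  refine measure_mono_null ?_ h1
  intro z hz h2
  exact hz.2 fun _ => (h2 hz.1).trans (hcc x hxΩ).symm

/-- The constant function `1` in `H¹(Ω)`. -/
lemma exists_H1_one [IsFiniteMeasure (volume.restrict Ω)] :
    ∃ e : H1 Ω, toL2 e =ᵐ[volume.restrict Ω] (fun _ => (1 : ℝ)) ∧ wgrad e = 0 := by
  have hgrad : gradient (fun _ : Euc d => (1 : ℝ)) = fun _ => 0 := by
    funext x
    simp [gradient]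
  obtain ⟨e, h1, h2⟩ := exists_H1_of_contDiff (Ω := Ω) (f := fun _ : Euc d => (1 : ℝ))
    contDiff_const (memLp_const 1) (by rw [hgrad]; exact MemLp.zero)
  refine ⟨e, h1, ?_⟩
  rw [hgrad] at h2
  exact Lp.eq_zero_iff_ae_eq_zero.2 h2

lemma exists_H1_of_test {η : Euc d → ℝ} (hη : IsTestFunction Ω η) :
    ∃ u ∈ H10 Ω, toL2 u =ᵐ[volume.restrict Ω] η := by
  have hcont : Continuous (gradient η) :=
    (InnerProductSpace.toDual ℝ (Euc d)).symm.continuous.comp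
      (hη.smooth.continuous_fderiv (by simp))
  have hcomp : HasCompactSupport (gradient η) :=
    (hη.compact.fderiv (𝕜 := ℝ)).comp_left
      (g := (InnerProductSpace.toDual ℝ (Euc d)).symm) (map_zero _)
  obtain ⟨u, hu, -⟩ := exists_H1_of_contDiff (Ω := Ω) (hη.smooth.of_le (by simp)) hη.memLp
    (hcont.memLp_of_hasCompactSupport hcomp)
  exact ⟨u, Submodule.le_topologicalClosure _ (Submodule.subset_span ⟨η, hη, hu⟩), hu⟩

/-- `H¹₀(Ω)` contains arbitrarily large linearly independent families. -/
theorem exists_linearIndependent_H10 (hd : 1 ≤ d) (hΩ : IsOpen Ω) (hne : Ω.Nonempty) (j : ℕ) :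
    ∃ w : Fin j → H10 Ω, LinearIndependent ℝ w := by
  have : Nonempty (Fin d) := ⟨⟨0, hd⟩⟩
  have hinf : Ω.Infinite := by
    obtain ⟨x, hx⟩ := hne
    exact infinite_of_mem_nhds x (hΩ.mem_nhds hx)
  let p : Fin j → Euc d := fun i => hinf.natEmbedding _ i
  have hpΩ : ∀ i, p i ∈ Ω := fun i => (hinf.natEmbedding _ i).2
  have hpinj : Function.Injective p := fun i k h =>
    Fin.ext ((hinf.natEmbedding _).injective (Subtype.ext h))
  -- One radius for which all the balls lie in `Ω` and are pairwise disjoint; bumps on them are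
  -- orthogonal in `L²`.
  have hev : ∀ᶠ r in 𝓝[>] (0 : ℝ), ∀ i, Metric.closedBall (p i) r ⊆ Ω ∧
      ∀ k, k ≠ i → 2 * r < dist (p k) (p i) := by
    rw [eventually_all]
    intro i
    refine Eventually.and ?_ ?_
    · obtain ⟨ε, hε, h⟩ := Metric.isOpen_iff.1 hΩ (p i) (hpΩ i)
      filter_upwards [nhdsWithin_le_nhds (Iio_mem_nhds hε)] with r hr
      exact (Metric.closedBall_subset_ball hr).trans h
    · rw [eventually_all]
      intro k
      by_cases hk : k = i
      · exact Eventually.of_forall fun r h => absurd hk h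
      · have hpos : 0 < dist (p k) (p i) / 2 := half_pos (dist_pos.2 fun h => hk (hpinj h))
        filter_upwards [nhdsWithin_le_nhds (Iio_mem_nhds hpos)] with r hr _
        rw [Set.mem_Iio] at hr
        linarith
  obtain ⟨r, hr, hr0⟩ := (hev.and self_mem_nhdsWithin).exists
  have hr0 : 0 < r := hr0
  let f : ∀ i : Fin j, ContDiffBump (p i) := fun i => ⟨r / 2, r, half_pos hr0, half_lt_self hr0⟩
  have hf : ∀ i, IsTestFunction Ω (f i) := fun i =>
    ⟨(f i).contDiff, (f i).hasCompactSupport, by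
      rw [(f i).tsupport_eq]; exact (hr i).1⟩
  choose u hu hfu using fun i => exists_H1_of_test (hf i)
  refine ⟨fun i => ⟨u i, hu i⟩, ?_⟩
  refine LinearIndependent.of_comp ((toL2L Ω).toLinearMap.comp (H10 Ω).subtype) ?_
  refine linearIndependent_of_ne_zero_of_inner_eq_zero (𝕜 := ℝ) ?_ ?_
  · intro i h0
    have h1 : toL2 (u i) = 0 := h0
    have h2 : ∀ᵐ x ∂volume.restrict Ω, f i x = 0 := by
      filter_upwards [hfu i, Lp.eq_zero_iff_ae_eq_zero.1 h1] with x h3 h4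
      rw [← h3, h4]; rfl
    have hsub : Metric.ball (p i) r ⊆ Ω := Metric.ball_subset_closedBall.trans (hr i).1
    have hne : (ae (volume.restrict (Metric.ball (p i) r))).NeBot := by
      rw [ae_restrict_neBot]
      exact (Metric.measure_ball_pos volume (p i) hr0).ne'
    obtain ⟨x, h3, h4⟩ := ((ae_restrict_of_ae_restrict_of_subset hsub h2).and
      (ae_restrict_mem Metric.isOpen_ball.measurableSet)).exists
    exact ((f i).pos_of_mem_ball h4).ne' h3
  · intro i k hik
    have : inner ℝ (toL2 (u i)) (toL2 (u k)) = 0 := by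
      rw [L2.inner_def, integral_eq_zero_of_ae]
      filter_upwards [hfu i, hfu k] with x h1 h2
      rw [h1, h2]
      by_cases hx : x ∈ Metric.ball (p i) r
      · have : f k x = 0 := by
          refine (f k).zero_of_le_dist ?_
          rw [Metric.mem_ball] at hx
          have h3 := (hr i).2 k hik.symm
          have h4 := dist_triangle (p k) x (p i)
          rw [dist_comm (p k) x] at h4
          change r ≤ dist x (p k)
          linarith
        simp [this]
      · have : f i x = 0 := (f i).zero_of_le_dist (by simpa using hx)
        simp [this]
    exact this

end ZeroGradient

/-! ### Bounds on the coefficients -/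

section Coefficients

variable {α : Type*} [MeasurableSpace α] {μ : Measure α}

/-- A limit of a bounded sequence in `L^∞` obeys the same bound. -/
lemma ae_abs_le_of_tendsto {f : ℕ → α → ℝ} {f₀ : α → ℝ} {R : ℝ}
    (h : ∀ k, ∀ᵐ x ∂μ, |f k x| ≤ R) (hlim : ∀ᵐ x ∂μ, Tendsto (fun k => f k x) atTop (𝓝 (f₀ x))) :
    ∀ᵐ x ∂μ, |f₀ x| ≤ R := by
  filter_upwards [ae_all_iff.2 h, hlim] with x h1 h2
  exact le_of_tendsto' h2.abs h1

/-- The maximum appears because `ENNReal.ofReal` sends negative numbers to `0`. -/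
lemma ae_abs_le_of_eLpNorm_top_le {f : α → ℝ} {R : ℝ}
    (h : eLpNorm f ⊤ μ ≤ ENNReal.ofReal R) : ∀ᵐ x ∂μ, |f x| ≤ max R 0 := by
  rw [eLpNorm_exponent_top] at h
  filter_upwards [ae_le_eLpNormEssSup (f := f) (μ := μ)] with x hx
  have h1 := (ENNReal.toReal_mono ENNReal.ofReal_ne_top (hx.trans h))
  rwa [toReal_enorm, Real.norm_eq_abs, ENNReal.toReal_ofReal'] at h1

lemma exists_bound_comp {m : ℝ → ℝ} (hm : Continuous m) (R : ℝ) :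
    ∃ B : ℝ, ∀ s, |s| ≤ R → |m s| ≤ B := by
  obtain ⟨B, hB⟩ := (isCompact_Icc (a := -R) (b := R)).exists_bound_of_continuousOn hm.continuousOn
  exact ⟨B, fun s hs => hB s (abs_le.1 hs)⟩

end Coefficients

/-! ### Stability of weak convergence under bounded maps -/

section Composition

variable {H H' X : Type*} [NormedAddCommGroup H] [InnerProductSpace ℝ H]
  [NormedAddCommGroup H'] [InnerProductSpace ℝ H'] [NormedAddCommGroup X] [NormedSpace ℝ X]

lemma WeakTendsto.map {u : ℕ → H} {u₀ : H} (h : WeakTendsto u u₀) (f : H →L[ℝ] H') :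
    WeakTendsto (fun n => f (u n)) (f u₀) := fun g => h (g.comp f)

lemma IsCompletelyContinuous.comp {J : H' →L[ℝ] X} (hJ : IsCompletelyContinuous J)
    (f : H →L[ℝ] H') : IsCompletelyContinuous (J.comp f) := by
  intro u u₀ R hR hu
  refine hJ _ _ (‖f‖ * R) (fun n => ?_) (hu.map f)
  exact (f.le_opNorm _).trans (by gcongr; exact hR n)

end Composition

/-! ### The energy and mass forms of the eigenvalue problems -/

section Forms

variable {d : ℕ} {Ω : Set (Euc d)} {H : Type*} [NormedAddCommGroup H] [InnerProductSpace ℝ H]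

/-- The form `∫ a ∇u · ∇v + ∫ b u v` pulled back along `ι : H → H¹(Ω)`. -/
noncomputable def energyForm (ι : H →L[ℝ] H1 Ω) {a b : Euc d → ℝ} {B : ℝ}
    (ha : AEStronglyMeasurable a (volume.restrict Ω)) (haB : ∀ᵐ x ∂volume.restrict Ω, |a x| ≤ B)
    (hb : AEStronglyMeasurable b (volume.restrict Ω)) (hbB : ∀ᵐ x ∂volume.restrict Ω, |b x| ≤ B) :
    H →L[ℝ] H →L[ℝ] ℝ :=
  (mulForm ha haB).bilinearComp ((wgradL Ω).comp ι) ((wgradL Ω).comp ι)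
    + (mulForm hb hbB).bilinearComp ((toL2L Ω).comp ι) ((toL2L Ω).comp ι)

/-- The form `∫ c u v` pulled back along `ι : H → H¹(Ω)`. -/
noncomputable def massForm (ι : H →L[ℝ] H1 Ω) {c : Euc d → ℝ} {B : ℝ}
    (hc : AEStronglyMeasurable c (volume.restrict Ω)) (hcB : ∀ᵐ x ∂volume.restrict Ω, |c x| ≤ B) :
    H →L[ℝ] H →L[ℝ] ℝ :=
  (mulForm hc hcB).bilinearComp ((toL2L Ω).comp ι) ((toL2L Ω).comp ι)

lemma mulForm_eq_weightedProd {m : ℝ → ℝ} {φ : Euc d → ℝ} {B : ℝ}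
    (hm : AEStronglyMeasurable (fun x => m (φ x)) (volume.restrict Ω))
    (hmB : ∀ᵐ x ∂volume.restrict Ω, |m (φ x)| ≤ B) (u v : L2 Ω) :
    mulForm hm hmB u v = weightedProd m φ u v := by
  rw [mulForm_apply, weightedProd]
  refine integral_congr_ae (ae_of_all _ fun x => ?_)
  simp [mul_comm (u x)]

variable (ι : H →L[ℝ] H1 Ω) {B : ℝ}

lemma energyForm_apply {a b : ℝ → ℝ} {φ : Euc d → ℝ}
    (ha : AEStronglyMeasurable (fun x => a (φ x)) (volume.restrict Ω))
    (haB : ∀ᵐ x ∂volume.restrict Ω, |a (φ x)| ≤ B)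
    (hb : AEStronglyMeasurable (fun x => b (φ x)) (volume.restrict Ω))
    (hbB : ∀ᵐ x ∂volume.restrict Ω, |b (φ x)| ≤ B) (u v : H) :
    energyForm ι ha haB hb hbB u v = weightedProdVec a φ (wgrad (ι u)) (wgrad (ι v))
      + weightedProd b φ (toL2 (ι u)) (toL2 (ι v)) := by
  rw [weightedProdVec, ← mulForm_apply ha haB, ← mulForm_eq_weightedProd hb hbB]
  rfl

lemma massForm_apply {c : ℝ → ℝ} {φ : Euc d → ℝ}
    (hc : AEStronglyMeasurable (fun x => c (φ x)) (volume.restrict Ω))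
    (hcB : ∀ᵐ x ∂volume.restrict Ω, |c (φ x)| ≤ B) (u v : H) :
    massForm ι hc hcB u v = weightedProd c φ (toL2 (ι u)) (toL2 (ι v)) := by
  rw [← mulForm_eq_weightedProd hc hcB]
  rfl

/-- For coercivity, the energy controls the gradient part of the `H¹` norm and the mass form the
`L²` part; nothing depends on boundary conditions. -/
lemma isFormPair_energyForm_massForm (hι : ∀ u, ‖ι u‖ = ‖u‖) {a b c : Euc d → ℝ} {γ : ℝ}
    (hγ : 0 < γ)
    (ha : AEStronglyMeasurable a (volume.restrict Ω)) (haB : ∀ᵐ x ∂volume.restrict Ω, |a x| ≤ B)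
    (hb : AEStronglyMeasurable b (volume.restrict Ω)) (hbB : ∀ᵐ x ∂volume.restrict Ω, |b x| ≤ B)
    (hc : AEStronglyMeasurable c (volume.restrict Ω)) (hcB : ∀ᵐ x ∂volume.restrict Ω, |c x| ≤ B)
    (haγ : ∀ x, γ ≤ a x) (hb0 : ∀ x, 0 ≤ b x) (hcγ : ∀ x, γ ≤ c x) :
    IsFormPair ((toL2L Ω).comp ι) γ B (energyForm ι ha haB hb hbB) (massForm ι hc hcB) := by
  have h1 := fun u : H => le_mulForm ha haB (ae_of_all _ haγ) (wgrad (ι u))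
  have h2 := fun u : H => le_mulForm hb hbB (ae_of_all _ hb0) (toL2 (ι u))
  have h3 := fun u : H => le_mulForm hc hcB (ae_of_all _ hcγ) (toL2 (ι u))
  have eA : ∀ u v, energyForm ι ha haB hb hbB u v
      = mulForm ha haB (wgrad (ι u)) (wgrad (ι v)) + mulForm hb hbB (toL2 (ι u)) (toL2 (ι v)) :=
    fun u v => rfl
  have eC : ∀ u v, massForm ι hc hcB u v = mulForm hc hcB (toL2 (ι u)) (toL2 (ι v)) :=
    fun u v => rfl
  have hA : ∀ u, γ * ‖wgrad (ι u)‖ ^ 2 ≤ energyForm ι ha haB hb hbB u u := fun u => by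
    rw [eA]
    linarith [h1 u, h2 u]
  refine ⟨fun u v => ?_, fun u v => ?_, fun u => ?_, fun u => ?_, fun u v => ?_, fun u => ?_⟩
  · rw [eA, eA, mulForm_symm ha, mulForm_symm hb]
  · rw [eC, eC, mulForm_symm hc]
  · exact (by positivity : (0 : ℝ) ≤ γ * ‖wgrad (ι u)‖ ^ 2).trans (hA u)
  · rw [eC]
    exact h3 u
  · rw [eC]
    exact abs_mulForm_le hc hcB _ _
  · rw [← hι u, H1_norm_sq, eC]
    linarith [hA u, h3 u]

lemma isEig_energyForm_iff {a b c : ℝ → ℝ} {φ : Euc d → ℝ}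
    (ha : AEStronglyMeasurable (fun x => a (φ x)) (volume.restrict Ω))
    (haB : ∀ᵐ x ∂volume.restrict Ω, |a (φ x)| ≤ B)
    (hb : AEStronglyMeasurable (fun x => b (φ x)) (volume.restrict Ω))
    (hbB : ∀ᵐ x ∂volume.restrict Ω, |b (φ x)| ≤ B)
    (hc : AEStronglyMeasurable (fun x => c (φ x)) (volume.restrict Ω))
    (hcB : ∀ᵐ x ∂volume.restrict Ω, |c (φ x)| ≤ B) (s : ℝ) (w : H) :
    IsEig (energyForm ι ha haB hb hbB) (massForm ι hc hcB) s w ↔ w ≠ 0 ∧ ∀ η,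
      weightedProdVec a φ (wgrad (ι w)) (wgrad (ι η)) + weightedProd b φ (toL2 (ι w)) (toL2 (ι η))
        = s * weightedProd c φ (toL2 (ι w)) (toL2 (ι η)) := by
  simp only [IsEig, energyForm_apply, massForm_apply]

/-- Coefficients along an almost everywhere convergent, uniformly bounded sequence. -/
structure CoeffBound (Ω : Set (Euc d)) (m : ℝ → ℝ) (B : ℝ) (φ : ℕ → Euc d → ℝ) (φ₀ : Euc d → ℝ) :
    Prop where
  meas : ∀ k, AEStronglyMeasurable (fun x => m (φ k x)) (volume.restrict Ω)
  meas₀ : AEStronglyMeasurable (fun x => m (φ₀ x)) (volume.restrict Ω)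
  bound : ∀ k, ∀ᵐ x ∂volume.restrict Ω, |m (φ k x)| ≤ B
  bound₀ : ∀ᵐ x ∂volume.restrict Ω, |m (φ₀ x)| ≤ B
  tendsto : ∀ᵐ x ∂volume.restrict Ω, Tendsto (fun k => m (φ k x)) atTop (𝓝 (m (φ₀ x)))

lemma coeffBound_of_continuous {m : ℝ → ℝ} (hm : Continuous m) {φ : ℕ → Euc d → ℝ}
    {φ₀ : Euc d → ℝ} {R : ℝ} (hφ : ∀ k, AEStronglyMeasurable (φ k) (volume.restrict Ω))
    (hR : ∀ k, ∀ᵐ x ∂volume.restrict Ω, |φ k x| ≤ R)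
    (hlim : ∀ᵐ x ∂volume.restrict Ω, Tendsto (fun k => φ k x) atTop (𝓝 (φ₀ x))) {B : ℝ}
    (hB : ∀ s, |s| ≤ R → |m s| ≤ B) : CoeffBound Ω m B φ φ₀ where
  meas k := hm.comp_aestronglyMeasurable (hφ k)
  meas₀ := hm.comp_aestronglyMeasurable (aestronglyMeasurable_of_tendsto_ae atTop hφ hlim)
  bound k := (hR k).mono fun _ hx => hB _ hx
  bound₀ := (ae_abs_le_of_tendsto hR hlim).mono fun _ hx => hB _ hx
  tendsto := hlim.mono fun _ hx => (hm.tendsto _).comp hx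

lemma formsTendsto (hι : ∀ u, ‖ι u‖ = ‖u‖) {a b c : ℝ → ℝ} {γ : ℝ} (hγ : 0 < γ)
    {φ : ℕ → Euc d → ℝ} {φ₀ : Euc d → ℝ}
    (ha : CoeffBound Ω a B φ φ₀) (hb : CoeffBound Ω b B φ φ₀) (hc : CoeffBound Ω c B φ φ₀)
    (haγ : ∀ s, γ ≤ a s) (hb0 : ∀ s, 0 ≤ b s) (hcγ : ∀ s, γ ≤ c s) :
    FormsTendsto ((toL2L Ω).comp ι) γ B
      (fun k => energyForm ι (ha.meas k) (ha.bound k) (hb.meas k) (hb.bound k))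
      (fun k => massForm ι (hc.meas k) (hc.bound k))
      (energyForm ι ha.meas₀ ha.bound₀ hb.meas₀ hb.bound₀) (massForm ι hc.meas₀ hc.bound₀) := by
  refine ⟨fun k => isFormPair_energyForm_massForm ι hι hγ _ _ _ _ _ _ (fun _ => haγ _)
      (fun _ => hb0 _) (fun _ => hcγ _), isFormPair_energyForm_massForm ι hι hγ _ _ _ _ _ _
      (fun _ => haγ _) (fun _ => hb0 _) (fun _ => hcγ _), fun v => ?_, fun v => ?_⟩
  · have h1 := tendsto_mulForm ha.meas ha.meas₀ ha.bound ha.bound₀ ha.tendsto (wgrad (ι v))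
    have h2 := tendsto_mulForm hb.meas hb.meas₀ hb.bound hb.bound₀ hb.tendsto (toL2 (ι v))
    exact (((ContinuousLinearMap.precomp ℝ ((wgradL Ω).comp ι)).continuous.tendsto _).comp h1).add
      (((ContinuousLinearMap.precomp ℝ ((toL2L Ω).comp ι)).continuous.tendsto _).comp h2)
  · have h2 := tendsto_mulForm hc.meas hc.meas₀ hc.bound hc.bound₀ hc.tendsto (toL2 (ι v))
    exact ((ContinuousLinearMap.precomp ℝ ((toL2L Ω).comp ι)).continuous.tendsto _).comp h2

lemma tendsto_weightedNorm_sub {c : ℝ → ℝ} {φ : Euc d → ℝ}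
    (hc : AEStronglyMeasurable (fun x => c (φ x)) (volume.restrict Ω))
    (hcB : ∀ᵐ x ∂volume.restrict Ω, |c (φ x)| ≤ B) {u : ℕ → L2 Ω} {v : L2 Ω}
    (h : Tendsto u atTop (𝓝 v)) :
    Tendsto (fun n => weightedNorm c φ (u n - v)) atTop (𝓝 0) := by
  have h1 : ∀ w : L2 Ω, weightedProd c φ w w = mulForm hc hcB w w := fun w => by
    simp only [mulForm_apply, weightedProd, RCLike.inner_apply, conj_trivial]
  have h2 : Continuous fun w : L2 Ω => Real.sqrt (mulForm hc hcB w w) :=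
    ((mulForm hc hcB).continuous.clm_apply continuous_id).sqrt
  have h3 := (h2.tendsto 0).comp (by simpa using h.sub_const v : Tendsto (fun n => u n - v) atTop (𝓝 0))
  simp only [map_zero, Real.sqrt_zero] at h3
  refine h3.congr fun n => ?_
  simp only [weightedNorm, h1, Function.comp]

end Forms

/-! ### The continuity theorem on a space embedded in `H¹` -/

section Generic

variable {d : ℕ} {Ω : Set (Euc d)} {H : Type*} [NormedAddCommGroup H] [InnerProductSpace ℝ H]

/-- Eigenfunctions of the weak eigenvalue problem posed in a space `H` that is embedded
isometrically in `H¹(Ω)`. -/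
def IsEigenfunctionIn (ι : H →ₗᵢ[ℝ] H1 Ω) (a b c : ℝ → ℝ) (φ : Euc d → ℝ) (s : ℝ) (w : H) : Prop :=
  w ≠ 0 ∧ ∀ η, weightedProdVec a φ (wgrad (ι w)) (wgrad (ι η))
    + weightedProd b φ (toL2 (ι w)) (toL2 (ι η)) = s * weightedProd c φ (toL2 (ι w)) (toL2 (ι η))

/-- The numbers that bound the eigenvalues of `j` linearly independent eigenfunctions. -/
def eigenvalueBounds (ι : H →ₗᵢ[ℝ] H1 Ω) (a b c : ℝ → ℝ) (φ : Euc d → ℝ) (j : ℕ) : Set ℝ :=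
  {t | ∃ w : Fin j → H, LinearIndependent ℝ w ∧ ∀ i, ∃ s ≤ t, IsEigenfunctionIn ι a b c φ s (w i)}

/-- Continuity of eigenvalues and eigenfunctions for the problem posed in `H`. -/
theorem tendsto_eigenvalues_eigenfunctions [CompleteSpace H] [TopologicalSpace.SeparableSpace H]
    (hΩ : IsBoundedLipschitzDomain Ω) (ι : H →ₗᵢ[ℝ] H1 Ω) {a b c : ℝ → ℝ} {γ B : ℝ} (hγ : 0 < γ)
    {φ : ℕ → Euc d → ℝ} {φ₀ : Euc d → ℝ}
    (ha : CoeffBound Ω a B φ φ₀) (hb : CoeffBound Ω b B φ φ₀) (hc : CoeffBound Ω c B φ φ₀)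
    (haγ : ∀ s, γ ≤ a s) (hb0 : ∀ s, 0 ≤ b s) (hcγ : ∀ s, γ ≤ c s) {j : ℕ} (hj : 0 < j)
    {w : Fin j → H} (hw : LinearIndependent ℝ w) :
    Tendsto (fun k => sInf (eigenvalueBounds ι a b c (φ k) j)) atTop
      (𝓝 (sInf (eigenvalueBounds ι a b c φ₀ j))) ∧
    sInf (eigenvalueBounds ι a b c φ₀ j) ∈ eigenvalueBounds ι a b c φ₀ j ∧
    ∀ (p : ℕ → ℕ), StrictMono p → ∀ u : ℕ → H,
      (∀ k, IsEigenfunctionIn ι a b c (φ (p k)) (sInf (eigenvalueBounds ι a b c (φ (p k)) j)) (u k) ∧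
        weightedNorm c (φ (p k)) (toL2 (ι (u k))) = 1) →
      ∃ (v : H) (n : ℕ → ℕ), StrictMono n ∧
        IsEigenfunctionIn ι a b c φ₀ (sInf (eigenvalueBounds ι a b c φ₀ j)) v ∧
        weightedNorm c φ₀ (toL2 (ι v)) = 1 ∧
        TendstoWeaklyH1 (fun i => ι (u (n i))) (ι v) ∧
        Tendsto (fun i => weightedNorm c φ₀ (toL2 (ι (u (n i))) - toL2 (ι v))) atTop (𝓝 0) := by
  have hF := formsTendsto ι.toContinuousLinearMap ι.norm_map hγ ha hb hc haγ hb0 hcγ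
  have hJ := (isCompletelyContinuous_toL2 hΩ).comp ι.toContinuousLinearMap
  have hinj : Function.Injective ((toL2L Ω).comp ι.toContinuousLinearMap) :=
    (toL2_injective hΩ.isOpen).comp ι.injective
  have hset : ∀ k, eigenvalueBounds ι a b c (φ k) j = eigSet
      (energyForm ι.toContinuousLinearMap (ha.meas k) (ha.bound k) (hb.meas k) (hb.bound k))
      (massForm ι.toContinuousLinearMap (hc.meas k) (hc.bound k)) j := fun k => by
    simp only [eigenvalueBounds, eigSet, isEig_energyForm_iff]
    rfl
  have hset₀ : eigenvalueBounds ι a b c φ₀ j = eigSet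
      (energyForm ι.toContinuousLinearMap ha.meas₀ ha.bound₀ hb.meas₀ hb.bound₀)
      (massForm ι.toContinuousLinearMap hc.meas₀ hc.bound₀) j := by
    simp only [eigenvalueBounds, eigSet, isEig_energyForm_iff]
    rfl
  have hl := hF.tendsto_sInf_eigSet hγ hinj hJ hj hw
  simp only [← hset, ← hset₀] at hl
  refine ⟨hl, ?_, fun p hp u hu => ?_⟩
  · have h := hF.limit.sInf_mem_eigSet hγ hinj hJ hj hw
    rwa [← hset₀] at h
  · have hu' : ∀ k, IsEig
        (energyForm ι.toContinuousLinearMap (ha.meas (p k)) (ha.bound (p k)) (hb.meas (p k))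
          (hb.bound (p k)))
        (massForm ι.toContinuousLinearMap (hc.meas (p k)) (hc.bound (p k)))
        (sInf (eigenvalueBounds ι a b c (φ (p k)) j)) (u k) := fun k =>
      (isEig_energyForm_iff ι.toContinuousLinearMap (ha.meas (p k)) (ha.bound (p k))
        (hb.meas (p k)) (hb.bound (p k)) (hc.meas (p k)) (hc.bound (p k)) _ _).2 (hu k).1
    have hu1 : ∀ k, massForm ι.toContinuousLinearMap (hc.meas (p k)) (hc.bound (p k)) (u k) (u k)
        = 1 := fun k => by
      rw [massForm_apply]
      exact Real.sqrt_eq_one.1 (hu k).2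
    obtain ⟨v, n, hn, hv, hv1, hwk, hst⟩ := (hF.comp hp).exists_subseq_eig hγ hJ
      (hl.comp hp.tendsto_atTop) hu' hu1
    rw [massForm_apply] at hv1
    exact ⟨v, n, hn, (isEig_energyForm_iff ι.toContinuousLinearMap ha.meas₀ ha.bound₀
      hb.meas₀ hb.bound₀ hc.meas₀ hc.bound₀ _ _).1 hv, Real.sqrt_eq_one.2 hv1,
      hwk.map ι.toContinuousLinearMap, tendsto_weightedNorm_sub hc.meas₀ hc.bound₀ hst⟩

end Generic

/-! ### The Dirichlet and Neumann problems as instances -/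

section Identification

variable {d : ℕ} {Ω : Set (Euc d)} {B : ℝ} {a b c : ℝ → ℝ} {φ : Euc d → ℝ}

lemma isDirichletEigenfunction_iff (s : ℝ) (w : H10 Ω) :
    IsDirichletEigenfunction Ω a b c φ s w ↔
      IsEigenfunctionIn (H := H10 Ω) (H10 Ω).subtypeₗᵢ a b c φ s w := by
  constructor
  · rintro ⟨-, h0, h⟩
    exact ⟨fun h' => h0 (by rw [h']; rfl), fun η => h η η.2⟩
  · rintro ⟨h0, h⟩
    exact ⟨w.2, fun h' => h0 (Subtype.ext h'), fun η hη => h ⟨η, hη⟩⟩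

lemma dirichletEigenvalue_eq (j : ℕ) : dirichletEigenvalue Ω a b c φ j
    = sInf (eigenvalueBounds (H := H10 Ω) (H10 Ω).subtypeₗᵢ a b c φ j) := by
  unfold dirichletEigenvalue
  congr 1
  ext t
  constructor
  · rintro ⟨w, hw, h⟩
    have hmem : ∀ i, w i ∈ H10 Ω := fun i => by
      obtain ⟨s, -, hs⟩ := h i
      exact hs.1
    refine ⟨fun i => ⟨w i, hmem i⟩, LinearIndependent.of_comp (H10 Ω).subtype hw, fun i => ?_⟩
    obtain ⟨s, hst, hs⟩ := h i
    exact ⟨s, hst, (isDirichletEigenfunction_iff s ⟨w i, hmem i⟩).1 hs⟩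
  · rintro ⟨w, hw, h⟩
    refine ⟨fun i => w i, hw.map' (H10 Ω).subtype (Submodule.ker_subtype _), fun i => ?_⟩
    obtain ⟨s, hst, hs⟩ := h i
    exact ⟨s, hst, (isDirichletEigenfunction_iff s (w i)).2 hs⟩

lemma isNeumannEigenfunction_iff (s : ℝ) (w : H1 Ω) :
    IsNeumannEigenfunction Ω a c φ s w ↔
      IsEigenfunctionIn .id a (fun _ => 0) c φ s w := by
  have h0 : ∀ u v : L2 Ω, weightedProd (fun _ => 0) φ u v = 0 := fun u v => by
    simp [weightedProd]
  simp only [IsNeumannEigenfunction, IsEigenfunctionIn, h0, add_zero]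
  rfl

/-- The Neumann problem is the case `b = 0` on all of `H¹`; the index shift accounts for numbering
from `μ₀ = 0`. -/
lemma neumannEigenvalue_eq (j : ℕ) : neumannEigenvalue Ω a c φ j
    = sInf (eigenvalueBounds (.id : H1 Ω →ₗᵢ[ℝ] H1 Ω) a (fun _ => 0) c φ (j + 1)) := by
  simp only [neumannEigenvalue, eigenvalueBounds, isNeumannEigenfunction_iff]

/-- There is only one Neumann eigenfunction with a nonpositive eigenvalue, up to scaling. -/
lemma not_linearIndependent_of_neumann_nonpos (hΩ : IsBoundedLipschitzDomain Ω) {γ : ℝ}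
    (hγ : 0 < γ) (ha : AEStronglyMeasurable (fun x => a (φ x)) (volume.restrict Ω))
    (haB : ∀ᵐ x ∂volume.restrict Ω, |a (φ x)| ≤ B) (haγ : ∀ s, γ ≤ a s) (hc0 : ∀ s, 0 ≤ c s)
    {m : ℕ} (hm : 2 ≤ m) {w : Fin m → H1 Ω}
    (hw : ∀ i, ∃ s ≤ 0, IsNeumannEigenfunction Ω a c φ s (w i)) : ¬ LinearIndependent ℝ w := by
  have := hΩ.isFiniteMeasure
  intro hli
  -- Testing with the eigenfunction itself, a nonpositive eigenvalue leaves no room for a gradient.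
  have hgrad : ∀ i, wgrad (w i) = 0 := by
    intro i
    obtain ⟨s, hs0, -, hs⟩ := hw i
    have h1 := hs (w i)
    have h2 := le_mulForm ha haB (ae_of_all _ fun _ => haγ _) (wgrad (w i))
    rw [mulForm_apply] at h2
    have h3 : 0 ≤ weightedProd c φ (toL2 (w i)) (toL2 (w i)) :=
      integral_nonneg fun x => mul_nonneg (hc0 _) (mul_self_nonneg _)
    have h4 : γ * ‖wgrad (w i)‖ ^ 2 ≤ 0 := h2.trans (h1.le.trans (mul_nonpos_of_nonpos_of_nonneg hs0 h3))
    have h5 : ‖wgrad (w i)‖ ^ 2 ≤ 0 := nonpos_of_mul_nonpos_right h4 hγ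
    simpa using le_antisymm h5 (sq_nonneg _)
  choose k hk using fun i =>
    exists_ae_eq_const_of_wgrad_eq_zero hΩ.isOpen hΩ.isConnected (hgrad i)
  set i₀ : Fin m := ⟨0, by omega⟩
  set i₁ : Fin m := ⟨1, by omega⟩
  have hne : i₁ ≠ i₀ := by simp [i₀, i₁]
  -- Two constants are proportional; independence then forces the constant `k i₀` to vanish, and `w
  -- i₀` with it.
  have hcomb : k i₁ • w i₀ - k i₀ • w i₁ = 0 := by
    refine toL2_injective hΩ.isOpen ?_
    rw [map_zero, map_sub, map_smul, map_smul, toL2L_apply, toL2L_apply]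
    rw [Lp.eq_zero_iff_ae_eq_zero]
    filter_upwards [hk i₀, hk i₁, Lp.coeFn_sub (k i₁ • toL2 (w i₀)) (k i₀ • toL2 (w i₁)),
      Lp.coeFn_smul (k i₁) (toL2 (w i₀)), Lp.coeFn_smul (k i₀) (toL2 (w i₁))] with x h1 h2 h3 h4 h5
    rw [h3, Pi.sub_apply, h4, h5, Pi.smul_apply, Pi.smul_apply, h1, h2]
    simp [mul_comm]
  have h0 := Fintype.linearIndependent_iff.1 hli (Pi.single i₁ (-k i₀) + Pi.single i₀ (k i₁)) (by
    simp only [Pi.add_apply, add_smul, Finset.sum_add_distrib, Pi.single_apply, ite_smul, zero_smul,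
      Finset.sum_ite_eq', Finset.mem_univ, if_true]
    rw [← hcomb, neg_smul]
    abel) i₁
  have hk0 : k i₀ = 0 := by simpa [hne] using h0
  refine hli.ne_zero i₀ (toL2_injective hΩ.isOpen ?_)
  rw [map_zero, toL2L_apply, Lp.eq_zero_iff_ae_eq_zero]
  filter_upwards [hk i₀] with x hx
  rw [hx, hk0]; rfl

/-- Neumann eigenfunctions to nonzero eigenvalues have weighted mean zero. -/
lemma IsNeumannEigenfunction.mem_H1MeanZero [IsFiniteMeasure (volume.restrict Ω)] {s : ℝ}
    (hs : s ≠ 0) {w : H1 Ω} (hw : IsNeumannEigenfunction Ω a c φ s w) : w ∈ H1MeanZero Ω c φ := by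
  -- The constant function `1` is the test function: the energy term vanishes and `s` times the
  -- weighted mean remains.
  obtain ⟨e, he1, he2⟩ := exists_H1_one (Ω := Ω)
  have h1 := hw.2 e
  have h2 : weightedProdVec a φ (wgrad w) (wgrad e) = 0 := by
    rw [weightedProdVec, integral_eq_zero_of_ae]
    filter_upwards [Lp.eq_zero_iff_ae_eq_zero.1 he2] with x hx
    rw [hx]; simp
  have h3 : weightedProd c φ (toL2 w) (toL2 e) = ∫ x in Ω, c (φ x) * toL2 w x := by
    refine integral_congr_ae ?_
    filter_upwards [he1] with x hx
    rw [hx, mul_one]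
  rw [h2, h3] at h1
  exact (mul_eq_zero.1 h1.symm).resolve_left hs

end Identification

/-! ### Continuity for the Dirichlet and Neumann problems -/

section Identification

variable {d : ℕ} {Ω : Set (Euc d)} {B : ℝ} {a b c : ℝ → ℝ} {φ : Euc d → ℝ}

/-- Continuity of the Dirichlet eigenvalues and eigenfunctions. -/
theorem tendsto_dirichlet (hd : 1 ≤ d) (hΩ : IsBoundedLipschitzDomain Ω) {γ : ℝ} (hγ : 0 < γ)
    {φ : ℕ → Euc d → ℝ} {φ₀ : Euc d → ℝ}
    (ha : CoeffBound Ω a B φ φ₀) (hb : CoeffBound Ω b B φ φ₀) (hc : CoeffBound Ω c B φ φ₀)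
    (haγ : ∀ s, γ ≤ a s) (hb0 : ∀ s, 0 ≤ b s) (hcγ : ∀ s, γ ≤ c s) {j : ℕ} (hj : 0 < j) :
    Tendsto (fun k => dirichletEigenvalue Ω a b c (φ k) j) atTop
      (𝓝 (dirichletEigenvalue Ω a b c φ₀ j)) ∧
    ∀ u : ℕ → H1 Ω,
      (∀ k, IsDirichletEigenfunction Ω a b c (φ k) (dirichletEigenvalue Ω a b c (φ k) j) (u k) ∧
        weightedNorm c (φ k) (toL2 (u k)) = 1) →
      ∃ (v : H1 Ω) (n : ℕ → ℕ), StrictMono n ∧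
        IsDirichletEigenfunction Ω a b c φ₀ (dirichletEigenvalue Ω a b c φ₀ j) v ∧
        weightedNorm c φ₀ (toL2 v) = 1 ∧ TendstoWeaklyH1 (fun i => u (n i)) v ∧
        Tendsto (fun i => weightedNorm c φ₀ (toL2 (u (n i)) - toL2 v)) atTop (𝓝 0) := by
  obtain ⟨w, hw⟩ := exists_linearIndependent_H10 hd hΩ.isOpen hΩ.isConnected.nonempty j
  obtain ⟨hl, -, h⟩ := @tendsto_eigenvalues_eigenfunctions d Ω (H10 Ω) inferInstance inferInstance
    inferInstance inferInstance hΩ (H10 Ω).subtypeₗᵢ a b c γ B hγ φ φ₀ ha hb hc haγ hb0 hcγ j hj w hw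
  simp only [← dirichletEigenvalue_eq] at hl h
  refine ⟨hl, fun u hu => ?_⟩
  have hu0 : ∀ k, u k ∈ H10 Ω := fun k => (hu k).1.1
  obtain ⟨v, n, hn, hv, hv1, hwk, hst⟩ := h id strictMono_id (fun k => ⟨u k, hu0 k⟩)
    fun k => ⟨(isDirichletEigenfunction_iff _ ⟨u k, hu0 k⟩).1 (hu k).1, (hu k).2⟩
  exact ⟨v, n, hn, (isDirichletEigenfunction_iff _ v).2 hv, hv1, hwk, hst⟩

/-- Continuity of the Neumann eigenvalues and eigenfunctions. -/
theorem tendsto_neumann (hd : 1 ≤ d) (hΩ : IsBoundedLipschitzDomain Ω) {γ : ℝ} (hγ : 0 < γ)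
    {φ : ℕ → Euc d → ℝ} {φ₀ : Euc d → ℝ} (ha : CoeffBound Ω a B φ φ₀)
    (h0 : CoeffBound Ω (fun _ => 0) B φ φ₀) (hc : CoeffBound Ω c B φ φ₀)
    (haγ : ∀ s, γ ≤ a s) (hcγ : ∀ s, γ ≤ c s) {j : ℕ} (hj : 0 < j) :
    Tendsto (fun k => neumannEigenvalue Ω a c (φ k) j) atTop
      (𝓝 (neumannEigenvalue Ω a c φ₀ j)) ∧
    ∀ p : ℕ → ℕ, StrictMono p → ∀ u : ℕ → H1 Ω,
      (∀ k, IsNeumannEigenfunction Ω a c (φ (p k)) (neumannEigenvalue Ω a c (φ (p k)) j) (u k) ∧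
        weightedNorm c (φ (p k)) (toL2 (u k)) = 1) →
      ∃ (v : H1 Ω) (n : ℕ → ℕ), StrictMono n ∧
        IsNeumannEigenfunction Ω a c φ₀ (neumannEigenvalue Ω a c φ₀ j) v ∧ v ∈ H1MeanZero Ω c φ₀ ∧
        weightedNorm c φ₀ (toL2 v) = 1 ∧ TendstoWeaklyH1 (fun i => u (n i)) v ∧
        Tendsto (fun i => weightedNorm c φ₀ (toL2 (u (n i)) - toL2 v)) atTop (𝓝 0) := by
  have := hΩ.isFiniteMeasure
  obtain ⟨w, hw⟩ := exists_linearIndependent_H10 hd hΩ.isOpen hΩ.isConnected.nonempty (j + 1)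
  have hw := hw.map' (H10 Ω).subtype (Submodule.ker_subtype _)
  obtain ⟨hl, hmem, h⟩ := @tendsto_eigenvalues_eigenfunctions d Ω (H1 Ω) inferInstance inferInstance
    inferInstance inferInstance hΩ .id a (fun _ => 0) c γ B hγ φ φ₀ ha h0 hc haγ
    (fun _ => le_rfl) hcγ (j + 1) j.succ_pos _ hw
  simp only [← neumannEigenvalue_eq] at hl h hmem
  -- Since the infimum is attained, a zero value would give `j + 1 ≥ 2` independent eigenfunctions
  -- with nonpositive eigenvalues.
  have hμ : neumannEigenvalue Ω a c φ₀ j ≠ 0 := by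
    intro h0
    rw [h0] at hmem
    obtain ⟨w, hw, hs⟩ := hmem
    simp only [← isNeumannEigenfunction_iff] at hs
    exact not_linearIndependent_of_neumann_nonpos hΩ hγ ha.meas₀ ha.bound₀ haγ
      (fun s => hγ.le.trans (hcγ s)) (by omega) hs hw
  refine ⟨hl, fun p hp u hu => ?_⟩
  obtain ⟨v, n, hn, hv, hv1, hwk, hst⟩ := h p hp u
    fun k => ⟨(isNeumannEigenfunction_iff _ _).1 (hu k).1, (hu k).2⟩
  have hv := (isNeumannEigenfunction_iff _ _).2 hv
  exact ⟨v, n, hn, hv, hv.mem_H1MeanZero hμ, hv1, hwk, hst⟩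

end Identification

end PhaseFieldEigen

theorem mainTheorem11
    (d : ℕ) (hd : 1 ≤ d)
    (Ω : Set (Euc d)) (hΩ : IsBoundedLipschitzDomain Ω)
    (a b c : ℝ → ℝ)
    (ha : IsC11Loc a) (hb : IsC11Loc b) (hc : IsC11Loc c)
    (hac : ∃ C : ℝ, 0 < C ∧ ∀ s, C < a s ∧ C < c s) (hb0 : ∀ s, 0 ≤ b s)
    (j : ℕ) (hj : 1 ≤ j)
    (φ : ℕ → Euc d → ℝ) (φ₀ : Euc d → ℝ)
    (hφ : ∀ k, MemLp (φ k) ∞ (volume.restrict Ω))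
    (hbdd : ∃ M : ℝ, ∀ k, eLpNorm (φ k) ∞ (volume.restrict Ω) ≤ ENNReal.ofReal M)
    (hconv : ∀ᵐ x ∂(volume.restrict Ω), Tendsto (fun k => φ k x) atTop (𝓝 (φ₀ x))) :
    Tendsto (fun k => dirichletEigenvalue Ω a b c (φ k) j) atTop
        (𝓝 (dirichletEigenvalue Ω a b c φ₀ j)) ∧
    Tendsto (fun k => neumannEigenvalue Ω a c (φ k) j) atTop
        (𝓝 (neumannEigenvalue Ω a c φ₀ j)) ∧
    ∀ uD uN : ℕ → H1 Ω,
      (∀ k, IsDirichletEigenfunction Ω a b c (φ k) (dirichletEigenvalue Ω a b c (φ k) j) (uD k) ∧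
        weightedNorm c (φ k) (toL2 (uD k)) = 1) →
      (∀ k, IsNeumannEigenfunction Ω a c (φ k) (neumannEigenvalue Ω a c (φ k) j) (uN k) ∧
        weightedNorm c (φ k) (toL2 (uN k)) = 1) →
      ∃ vD vN : H1 Ω,
        IsDirichletEigenfunction Ω a b c φ₀ (dirichletEigenvalue Ω a b c φ₀ j) vD ∧
        weightedNorm c φ₀ (toL2 vD) = 1 ∧
        IsNeumannEigenfunction Ω a c φ₀ (neumannEigenvalue Ω a c φ₀ j) vN ∧
        vN ∈ H1MeanZero Ω c φ₀ ∧
        weightedNorm c φ₀ (toL2 vN) = 1 ∧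
        ∃ n : ℕ → ℕ, StrictMono n ∧
          TendstoWeaklyH1 (fun i => uD (n i)) vD ∧
          Tendsto (fun i => weightedNorm c φ₀ (toL2 (uD (n i)) - toL2 vD)) atTop (𝓝 0) ∧
          TendstoWeaklyH1 (fun i => uN (n i)) vN ∧
          Tendsto (fun i => weightedNorm c φ₀ (toL2 (uN (n i)) - toL2 vN)) atTop (𝓝 0) := by
  obtain ⟨γ, hγ, hγac⟩ := hac
  obtain ⟨M, hM⟩ := hbdd
  have := hΩ.isFiniteMeasure
  have hmeas := fun k => (hφ k).aestronglyMeasurable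
  have hR := fun k => ae_abs_le_of_eLpNorm_top_le (hM k)
  obtain ⟨Ba, hBa⟩ := exists_bound_comp ha.1.continuous (max M 0)
  obtain ⟨Bb, hBb⟩ := exists_bound_comp hb.1.continuous (max M 0)
  obtain ⟨Bc, hBc⟩ := exists_bound_comp hc.1.continuous (max M 0)
  -- The entry `0` lets the same bound serve the zero coefficient of the Neumann problem.
  set B := max (max Ba Bb) (max Bc 0)
  have Ha : CoeffBound Ω a B φ φ₀ := coeffBound_of_continuous ha.1.continuous hmeas hR hconv
    fun s hs => (hBa s hs).trans ((le_max_left _ _).trans (le_max_left _ _))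
  have Hb : CoeffBound Ω b B φ φ₀ := coeffBound_of_continuous hb.1.continuous hmeas hR hconv
    fun s hs => (hBb s hs).trans ((le_max_right _ _).trans (le_max_left _ _))
  have Hc : CoeffBound Ω c B φ φ₀ := coeffBound_of_continuous hc.1.continuous hmeas hR hconv
    fun s hs => (hBc s hs).trans ((le_max_left _ _).trans (le_max_right _ _))
  have H0 : CoeffBound Ω (fun _ => 0) B φ φ₀ :=
    coeffBound_of_continuous continuous_const hmeas hR hconv
      fun s _ => by rw [abs_zero]; exact (le_max_right _ _).trans (le_max_right _ _)
  have hγa : ∀ s, γ ≤ a s := fun s => (hγac s).1.le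
  have hγc : ∀ s, γ ≤ c s := fun s => (hγac s).2.le
  obtain ⟨hlD, hD⟩ := tendsto_dirichlet hd hΩ hγ Ha Hb Hc hγa hb0 hγc hj
  obtain ⟨hlN, hN⟩ := tendsto_neumann hd hΩ hγ Ha H0 Hc hγa hγc hj
  refine ⟨hlD, hlN, fun uD uN huD huN => ?_⟩
  obtain ⟨vD, p, hp, hvD, hvD1, hwkD, hstD⟩ := hD uD huD
  -- The Neumann extraction runs inside the Dirichlet subsequence `p`, which makes `p ∘ q` common to
  -- both.
  obtain ⟨vN, q, hq, hvN, hvN0, hvN1, hwkN, hstN⟩ := hN p hp (fun k => uN (p k)) fun k => huN (p k)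
  exact ⟨vD, vN, hvD, hvD1, hvN, hvN0, hvN1, fun i => p (q i), hp.comp hq,
    fun f => (hwkD f).comp hq.tendsto_atTop, hstD.comp hq.tendsto_atTop, hwkN, hstN⟩
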